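/- Let $\mathbb{F}_q$ be a finite field with $q$ odd and let $\psi:\mathbb{F}_q\to\mathbb{C}^\times$ be a non-trivial additive character. Let $\mathsf{Symp}$ be the groupoid of finite-dimensional symplectic vector spaces over $\mathbb{F}_q$ and symplectic linear isomorphisms. For $V=(V,\omega)\in\mathsf{Symp}$ of dimension $2n$, let $H(V)=V\times\mathbb{F}_q$ be the Heisenberg group, with product $(v,z)(v',z')=(v+v',\,z+z'+\tfrac12\omega(v,v'))$. An oriented Lagrangian is a pair $L^\circ=(L,o_L)$ of a Lagrangian subspace $L\subset V$ and a non-zero $o_L\in\bigwedge^{\mathrm{top}}L$. Put $$\mathcal{H}_{L^\circ}=\{f:H(V)\to\mathbb{C}\;:\; f((0,z)h)=\psi(z)f(h),\ f((l,0)h)=f(h)\ \text{ for all } z\in\mathbb{F}_q,\ l\in L,\ h\in H(V)\},$$ on which $H(V)$ acts by right translation. There is a unique (canonical) system of intertwining maps $F_{M^\circ,L^\circ}:\mathcal{H}_{L^\circ}\to\mathcal{H}_{M^\circ}$, indexed by all pairs of oriented Lagrangians, such that $F_{N^\circ,L^\circ}=F_{N^\circ,M^\circ}\circ F_{M^\circ,L^\circ}$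 for all triples and, whenever $L\cap M=0$, $$F_{M^\circ,L^\circ}[f](h)=(G_1/q)^n\,\sigma\big((-1)^{\binom n2}\omega_\wedge(o_L,o_M)\big)\sum_{m\in M}f((m,0)h).$$ Here $G_1=\sum_{z\in\mathbb{F}_q}\psi(z^2/2)$, $\sigma$ is the quadratic character of $\mathbb{F}_q^\times$, and $\omega_\wedge(l_1\wedge\dots\wedge l_n,\,m_1\wedge\dots\wedge m_n)=(-1)^{\binom n2}\det(\omega(l_i,m_j))$. Let $\mathcal{H}(V,\psi)$ be the space of families $(v_{L^\circ}\in\mathcal{H}_{L^\circ})_{L^\circ}$ such that $F_{M^\circ,L^\circ}(v_{L^\circ})=v_{M^\circ}$ for all $L^\circ,M^\circ$. A morphism $f:V\to U$ in $\mathsf{Symp}$ induces $\mathcal{H}(f):\mathcal{H}(U,\psi)\to\mathcal{H}(V,\psi)$ by $(\mathcal{H}(f)w)_{L^\circ}(v,z)=w_{f(L^\circ)}(f(v),z)$. Let $\overline V=(V,-\omega)$ be the symplectic dual of $V$, and for a morphism $f:V\to U$ let $\overline f:\overline V\to\overline U$ be the same linear map. Then there exists a family of non-degenerate bilinear pairings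 $$\langle\cdot,\cdot\rangle_V:\mathcal{H}(\overline V,\psi)\times\mathcal{H}(V,\psi)\to\mathbb{C},\qquad V\in\mathsf{Symp},$$ which is natural: $\langle\mathcal{H}(\overline f)a,\mathcal{H}(f)b\rangle_V=\langle a,b\rangle_U$ for every morphism $f:V\to U$ in $\mathsf{Symp}$, $a\in\mathcal{H}(\overline U,\psi)$ and $b\in\mathcal{H}(U,\psi)$. -/

import Mathlib

universe u v

noncomputable section

/-- A finite dimensional symplectic vector space over the field `F`. -/
structure Symp (F : Type v) [Field F] where
  /-- the underlying vector space -/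
  carrier : Type u
  [addCommGroup : AddCommGroup carrier]
  [module : Module F carrier]
  [finite : Module.Finite F carrier]
  /-- the symplectic form -/
  form : LinearMap.BilinForm F carrier
  isAlt : form.IsAlt
  nondegenerate : form.Nondegenerate

namespace Symp

variable {F : Type v} [Field F]

instance : CoeSort (Symp.{u} F) (Type u) := ⟨Symp.carrier⟩

attribute [instance] Symp.addCommGroup Symp.module Symp.finite

/-- The symplectic dual `(V, -ω)` of `(V, ω)`. -/
def dual (V : Symp.{u} F) : Symp.{u} F where
  carrier := V.carrier
  form := -V.form
  isAlt := V.isAlt.neg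
  nondegenerate := by
    refine ⟨fun x hx => V.nondegenerate.1 x fun y => ?_,
      fun y hy => V.nondegenerate.2 y fun x => ?_⟩
    · simpa using hx y
    · simpa using hy x

/-- Half the dimension of `V`. -/
def halfDim (V : Symp.{u} F) : ℕ := Module.finrank F V / 2

/-- Morphisms of symplectic vector spaces: linear isomorphisms preserving the forms. -/
structure Iso (V U : Symp.{u} F) extends V.carrier ≃ₗ[F] U.carrier where
  form_map : ∀ x y : V, U.form (toLinearEquiv x) (toLinearEquiv y) = V.form x y

/-- The inverse of an isomorphism of symplectic vector spaces. -/
def Iso.symm {V U : Symp.{u} F} (f : Iso V U) : Iso U V where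
  toLinearEquiv := f.toLinearEquiv.symm
  form_map x y := by rw [← f.form_map]; simp

/-- An isomorphism `V → U`, regarded as an isomorphism between the symplectic duals. -/
def Iso.dual {V U : Symp.{u} F} (f : Iso V U) : Iso V.dual U.dual where
  toLinearEquiv := f.toLinearEquiv
  form_map x y := congrArg Neg.neg (f.form_map x y)

theorem Iso.halfDim_eq {V U : Symp.{u} F} (f : Iso V U) : V.halfDim = U.halfDim := by
  unfold halfDim
  rw [f.toLinearEquiv.finrank_eq]

/-! ### The Heisenberg group -/

/-- The Heisenberg group `V × F`. -/
@[ext] structure Heis (V : Symp.{u} F) where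
  /-- the component in `V` -/
  vec : V
  /-- the central component -/
  ctr : F

instance (V : Symp.{u} F) : Group (Heis V) where
  mul h h' := ⟨h.vec + h'.vec, h.ctr + h'.ctr + 2⁻¹ * V.form h.vec h'.vec⟩
  one := ⟨0, 0⟩
  inv h := ⟨-h.vec, -h.ctr⟩
  mul_assoc a b c := by
    apply Heis.ext
    · exact add_assoc _ _ _
    · change a.ctr + b.ctr + 2⁻¹ * V.form a.vec b.vec + c.ctr
          + 2⁻¹ * V.form (a.vec + b.vec) c.vec
        = a.ctr + (b.ctr + c.ctr + 2⁻¹ * V.form b.vec c.vec)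
          + 2⁻¹ * V.form a.vec (b.vec + c.vec)
      simp only [map_add, LinearMap.add_apply]
      ring
  one_mul a := by
    apply Heis.ext
    · exact zero_add _
    · change 0 + a.ctr + 2⁻¹ * V.form 0 a.vec = a.ctr
      simp
  mul_one a := by
    apply Heis.ext
    · exact add_zero _
    · change a.ctr + 0 + 2⁻¹ * V.form a.vec 0 = a.ctr
      simp
  inv_mul_cancel a := by
    apply Heis.ext
    · exact neg_add_cancel _
    · change -a.ctr + a.ctr + 2⁻¹ * V.form (-a.vec) a.vec = 0
      simp [V.isAlt.self_eq_zero]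

/-- The inclusion of `V` (as a set) in the Heisenberg group. -/
def Heis.ofVec {V : Symp.{u} F} (x : V) : Heis V := ⟨x, 0⟩

/-- The inclusion of the center in the Heisenberg group. -/
def Heis.ofCtr {V : Symp.{u} F} (z : F) : Heis V := ⟨0, z⟩

/-- The isomorphism of Heisenberg groups induced by an isomorphism of symplectic spaces. -/
def Iso.heis {V U : Symp.{u} F} (f : Iso V U) : Heis V →* Heis U where
  toFun h := ⟨f.toLinearEquiv h.vec, h.ctr⟩
  map_one' := Heis.ext (map_zero f.toLinearEquiv) rfl
  map_mul' a b := by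
    apply Heis.ext
    · exact map_add f.toLinearEquiv _ _
    · change a.ctr + b.ctr + 2⁻¹ * V.form a.vec b.vec = a.ctr + b.ctr + 2⁻¹ * U.form _ _
      rw [f.form_map]

theorem Iso.heis_symm_heis {V U : Symp.{u} F} (f : Iso V U) (h : Heis V) :
    f.symm.heis (f.heis h) = h :=
  Heis.ext (f.toLinearEquiv.symm_apply_apply _) rfl

theorem Iso.heis_heis_symm {V U : Symp.{u} F} (f : Iso V U) (h : Heis U) :
    f.heis (f.symm.heis h) = h :=
  Heis.ext (f.toLinearEquiv.apply_symm_apply _) rfl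

/-! ### Oriented Lagrangian subspaces -/

/-- An oriented Lagrangian subspace: a subspace `L` with `L = L^⊥`, and a non-zero vector of
the top exterior power of `L`. The exterior algebra of `L` is viewed inside that of `V`, by the
(injective) homomorphism that the inclusion of `L` in `V` induces. -/
@[ext] structure OrientedLag (V : Symp.{u} F) where
  /-- the Lagrangian subspace -/
  space : Submodule F V
  lagrangian : V.form.orthogonal space = space
  /-- the orientation -/
  orient : ExteriorAlgebra F V
  orient_mem : orient ∈ (⋀[F]^(Module.finrank F space) space).map
    (ExteriorAlgebra.map space.subtype).toLinearMap
  orient_ne_zero : orient ≠ 0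

theorem map_exteriorPower_le {M N : Type*} [AddCommGroup M] [Module F M] [AddCommGroup N]
    [Module F N] (g : M →ₗ[F] N) (k : ℕ) :
    (⋀[F]^k M).map (ExteriorAlgebra.map g).toLinearMap ≤ ⋀[F]^k N := by
  change (LinearMap.range (ExteriorAlgebra.ι F) ^ k).map _ ≤ _
  rw [Submodule.map_pow]
  refine pow_le_pow_left' ?_ k
  rintro _ ⟨_, ⟨m, rfl⟩, rfl⟩
  exact ⟨g m, (ExteriorAlgebra.map_apply_ι g m).symm⟩

theorem finrank_lagrangian {V : Symp.{u} F} {L : Submodule F V}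
    (hL : V.form.orthogonal L = L) : Module.finrank F L = V.halfDim := by
  have h := LinearMap.BilinForm.finrank_orthogonal V.nondegenerate L
  rw [hL] at h
  have h' := Submodule.finrank_le L
  unfold halfDim
  omega

theorem OrientedLag.orient_mem_exteriorPower {V : Symp.{u} F} (L : V.OrientedLag) :
    L.orient ∈ ⋀[F]^V.halfDim V := by
  rw [← finrank_lagrangian L.lagrangian]
  exact map_exteriorPower_le _ _ L.orient_mem

/-- The orientation of an oriented Lagrangian, as a vector of the exterior power of `V`. -/
def OrientedLag.orientVec {V : Symp.{u} F} (L : V.OrientedLag) : ⋀[F]^V.halfDim V :=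
  ⟨L.orient, L.orient_mem_exteriorPower⟩

/-- The image of an oriented Lagrangian under an isomorphism of symplectic spaces. -/
def Iso.lag {V U : Symp.{u} F} (f : Iso V U) (L : V.OrientedLag) : U.OrientedLag where
  space := L.space.map f.toLinearEquiv.toLinearMap
  lagrangian := by
    ext y
    obtain ⟨x, rfl⟩ := f.toLinearEquiv.surjective y
    have hx : x ∈ V.form.orthogonal L.space ↔ x ∈ L.space := by rw [L.lagrangian]
    have hm : f.toLinearEquiv x ∈ L.space.map f.toLinearEquiv.toLinearMap ↔ x ∈ L.space := by
      constructor
      · rintro ⟨z, hz, hzx⟩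
        rwa [← f.toLinearEquiv.injective hzx]
      · exact fun h => ⟨x, h, rfl⟩
    rw [hm, ← hx]
    simp only [LinearMap.BilinForm.mem_orthogonal_iff]
    constructor
    · intro h z hz
      rw [← f.form_map]
      exact h _ ⟨z, hz, rfl⟩
    · rintro h _ ⟨z, hz, rfl⟩
      exact (f.form_map z x).trans (h z hz)
  orient := ExteriorAlgebra.map f.toLinearEquiv.toLinearMap L.orient
  orient_mem := by
    obtain ⟨o, ho, h⟩ := L.orient_mem
    rw [LinearEquiv.finrank_map_eq f.toLinearEquiv L.space]
    refine ⟨ExteriorAlgebra.map (f.toLinearEquiv.toLinearMap.submoduleMap L.space) o,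
      map_exteriorPower_le _ _ ⟨o, ho, rfl⟩, ?_⟩
    rw [← h]
    have e : (L.space.map f.toLinearEquiv.toLinearMap).subtype
          ∘ₗ f.toLinearEquiv.toLinearMap.submoduleMap L.space
        = f.toLinearEquiv.toLinearMap ∘ₗ L.space.subtype := rfl
    have e' := (ExteriorAlgebra.map_comp_map _ _).trans
      ((congrArg ExteriorAlgebra.map e).trans (ExteriorAlgebra.map_comp_map _ _).symm)
    exact DFunLike.congr_fun e' o
  orient_ne_zero h := by
    apply L.orient_ne_zero
    have e := DFunLike.congr_fun (ExteriorAlgebra.map_comp_map f.toLinearEquiv.toLinearMap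
      f.toLinearEquiv.symm.toLinearMap) L.orient
    rw [AlgHom.comp_apply, h, map_zero, f.toLinearEquiv.symm_comp, ExteriorAlgebra.map_id] at e
    exact e.symm

theorem Iso.lag_symm_lag {V U : Symp.{u} F} (f : Iso V U) (L : V.OrientedLag) :
    f.symm.lag (f.lag L) = L := by
  have hs : f.symm.toLinearEquiv.toLinearMap ∘ₗ f.toLinearEquiv.toLinearMap = LinearMap.id :=
    f.toLinearEquiv.symm_comp
  apply OrientedLag.ext
  · change (L.space.map f.toLinearEquiv.toLinearMap).map f.symm.toLinearEquiv.toLinearMap = _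
    rw [← Submodule.map_comp, hs, Submodule.map_id]
  · change ExteriorAlgebra.map f.symm.toLinearEquiv.toLinearMap
      (ExteriorAlgebra.map f.toLinearEquiv.toLinearMap L.orient) = _
    rw [← AlgHom.comp_apply, ExteriorAlgebra.map_comp_map, hs, ExteriorAlgebra.map_id]
    rfl

/-- The pairing `ω_∧` induced by the symplectic form. For vectors `o = l₁ ∧ ⋯ ∧ lₙ` and
`o' = m₁ ∧ ⋯ ∧ mₙ` of the top exterior powers of two Lagrangians it is
`(-1)^(n choose 2) * det (ω(lᵢ, mⱼ))`, which is the value of the volume form `ω^n / n!`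
(the Pfaffian of `ω`) at `(l₁, …, lₙ, m₁, …, mₙ)`. -/
def wedgePairing (V : Symp.{u} F) (o o' : ⋀[F]^V.halfDim V) : F :=
  (-1) ^ (V.halfDim.choose 2) *
    exteriorPower.pairingDual F V V.halfDim (exteriorPower.map V.halfDim V.form o) o'

theorem coe_exteriorPower_map {M N : Type*} [AddCommGroup M] [Module F M] [AddCommGroup N]
    [Module F N] (g : M →ₗ[F] N) (k : ℕ) (x : ⋀[F]^k M) :
    (exteriorPower.map k g x : ExteriorAlgebra F N) = ExteriorAlgebra.map g x := by
  have h : (⋀[F]^k N).subtype ∘ₗ exteriorPower.map k g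
      = (ExteriorAlgebra.map g).toLinearMap ∘ₗ (⋀[F]^k M).subtype := by
    apply exteriorPower.linearMap_ext
    ext m
    simp [Function.comp_def]
  exact DFunLike.congr_fun h x

theorem Iso.pairing_map {V U : Symp.{u} F} (f : Iso V U) (k : ℕ) (o o' : ⋀[F]^k V) :
    exteriorPower.pairingDual F U k (exteriorPower.map k U.form
        (exteriorPower.map k f.toLinearEquiv.toLinearMap o))
        (exteriorPower.map k f.toLinearEquiv.toLinearMap o')
      = exteriorPower.pairingDual F V k (exteriorPower.map k V.form o) o' := by
  have h : ((exteriorPower.pairingDual F U k ∘ₗ exteriorPower.map k U.form).compl₁₂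
      (exteriorPower.map k f.toLinearEquiv.toLinearMap)
      (exteriorPower.map k f.toLinearEquiv.toLinearMap))
      = exteriorPower.pairingDual F V k ∘ₗ exteriorPower.map k V.form := by
    apply exteriorPower.linearMap_ext
    ext m m'
    simp [f.form_map]
  exact DFunLike.congr_fun (DFunLike.congr_fun h o) o'

theorem Iso.wedgePairing_lag {V U : Symp.{u} F} (f : Iso V U) (L M : V.OrientedLag) :
    U.wedgePairing (f.lag L).orientVec (f.lag M).orientVec
      = V.wedgePairing L.orientVec M.orientVec := by
  have key : ∀ (n : ℕ) (_ : V.halfDim = n)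
      (hL : (f.lag L).orient ∈ ⋀[F]^n U) (hM : (f.lag M).orient ∈ ⋀[F]^n U),
      (-1) ^ (n.choose 2) * exteriorPower.pairingDual F U n
        (exteriorPower.map n U.form ⟨_, hL⟩) ⟨_, hM⟩
      = V.wedgePairing L.orientVec M.orientVec := by
    rintro n rfl hL hM
    have e : ∀ (N : V.OrientedLag) (hN : (f.lag N).orient ∈ ⋀[F]^V.halfDim U),
        (⟨_, hN⟩ : ⋀[F]^V.halfDim U)
          = exteriorPower.map V.halfDim f.toLinearEquiv.toLinearMap N.orientVec := fun N hN =>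
      Subtype.ext (coe_exteriorPower_map f.toLinearEquiv.toLinearMap _ N.orientVec).symm
    rw [e L hL, e M hM, f.pairing_map]
    rfl
  exact key _ f.halfDim_eq _ _

/-! ### The models of the Heisenberg representation -/

/-- The space `H_L` of functions `f` on the Heisenberg group such that
`f (z * h) = ψ z * f h` for `z` in the center and `f (l * h) = f h` for `l ∈ L`. -/
def model (ψ : AddChar F ℂ) (V : Symp.{u} F) (L : V.OrientedLag) : Submodule ℂ (Heis V → ℂ) where
  carrier := {f | (∀ z h, f (Heis.ofCtr z * h) = ψ z * f h) ∧
    ∀ l ∈ L.space, ∀ h, f (Heis.ofVec l * h) = f h}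
  add_mem' {f g} hf hg := by
    refine ⟨fun z h => ?_, fun l hl h => ?_⟩
    · simp only [Pi.add_apply, hf.1, hg.1, mul_add]
    · simp only [Pi.add_apply, hf.2 l hl, hg.2 l hl]
  zero_mem' := by simp
  smul_mem' c f hf := by
    refine ⟨fun z h => ?_, fun l hl h => ?_⟩
    · simp only [Pi.smul_apply, hf.1, smul_eq_mul]; ring
    · simp only [Pi.smul_apply, hf.2 l hl]

/-- The action of the Heisenberg group on `H_L` by right translation. -/
def modelRep (ψ : AddChar F ℂ) (V : Symp.{u} F) (L : V.OrientedLag) :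
    Representation ℂ (Heis V) (model ψ V L) where
  toFun h :=
    { toFun := fun f => ⟨fun h' => f.1 (h' * h), fun z h' => by
          change f.1 (Heis.ofCtr z * h' * h) = _
          rw [mul_assoc, f.2.1],
        fun l hl h' => by
          change f.1 (Heis.ofVec l * h' * h) = _
          rw [mul_assoc, f.2.2 l hl]⟩
      map_add' := fun _ _ => rfl
      map_smul' := fun _ _ => rfl }
  map_one' := by
    ext f h'
    exact congrArg f.1 (mul_one h')
  map_mul' a b := by
    ext f h'
    exact congrArg f.1 (mul_assoc h' a b).symm

/-- Systems of intertwining morphisms `F_{M,L} : H_L → H_M`, indexed by all pairs of oriented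
Lagrangians. -/
abbrev IntertwiningSystem (ψ : AddChar F ℂ) (V : Symp.{u} F) : Type _ :=
  ∀ M L : V.OrientedLag, (modelRep ψ V L).IntertwiningMap (modelRep ψ V M)

/-- The one-dimensional Gauss sum `∑ ψ(z² / 2)`. -/
def gaussSum₁ [Fintype F] (ψ : AddChar F ℂ) : ℂ := ∑ z : F, ψ (2⁻¹ * z ^ 2)

/-- The normalization constant `C_{M,L}`. -/
def normConst [Fintype F] [DecidableEq F] (ψ : AddChar F ℂ) (V : Symp.{u} F)
    (M L : V.OrientedLag) : ℂ :=
  (gaussSum₁ ψ / Fintype.card F) ^ V.halfDim *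
    (quadraticChar F ((-1) ^ (V.halfDim.choose 2) *
      V.wedgePairing L.orientVec M.orientVec) : ℤ)

/-- A system of intertwining morphisms is canonical if it is given by the normalized averaging
morphisms on pairs in general position, and it is multiplicative. -/
structure IsCanonical [Fintype F] [DecidableEq F] {ψ : AddChar F ℂ} {V : Symp.{u} F}
    (K : IntertwiningSystem ψ V) : Prop where
  restriction : ∀ M L : V.OrientedLag, Disjoint M.space L.space →
    ∀ (f : model ψ V L) (h : Heis V),
      (K M L f).1 h = normConst ψ V M L * ∑ᶠ m : M.space, f.1 (Heis.ofVec (m : V) * h)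
  multiplicative : ∀ N M L : V.OrientedLag, K N L = (K N M).comp (K M L)

/-- The canonical vector space `H(V, ψ)`: the families `(v_L)` with `v_L ∈ H_L`, indexed by the
oriented Lagrangians, such that `F_{M,L} v_L = v_M` for the canonical system `F`. -/
def canonicalSpace [Fintype F] [DecidableEq F] (ψ : AddChar F ℂ) (V : Symp.{u} F) :
    Submodule ℂ (∀ L : V.OrientedLag, model ψ V L) where
  carrier := {v | ∀ K : IntertwiningSystem ψ V, IsCanonical K → ∀ M L, K M L (v L) = v M}
  add_mem' {v w} hv hw K hK M L := by
    simp only [Pi.add_apply, map_add, hv K hK M L, hw K hK M L]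
  zero_mem' K _ M L := map_zero (K M L)
  smul_mem' c v hv K hK M L := by
    simp only [Pi.smul_apply, map_smul, hv K hK M L]

/-! ### Functoriality -/

/-- Pulling back functions along `f : V → U`, as a map `H_{L'}(U) → H_L(V)`, where `f(L) ⊆ L'`. -/
def Iso.pull {V U : Symp.{u} F} (f : Iso V U) (ψ : AddChar F ℂ) (L : V.OrientedLag)
    (L' : U.OrientedLag) (hL : ∀ l ∈ L.space, f.toLinearEquiv l ∈ L'.space) :
    model ψ U L' →ₗ[ℂ] model ψ V L where
  toFun w := ⟨fun h => w.1 (f.heis h),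
    fun z h => by
      have e : f.heis (Heis.ofCtr z) = Heis.ofCtr z := Heis.ext (map_zero f.toLinearEquiv) rfl
      change w.1 (f.heis (Heis.ofCtr z * h)) = _
      rw [map_mul, e, w.2.1],
    fun l hl h => by
      have e : f.heis (Heis.ofVec l) = Heis.ofVec (f.toLinearEquiv l) := rfl
      change w.1 (f.heis (Heis.ofVec l * h)) = _
      rw [map_mul, e, w.2.2 _ (hL l hl)]⟩
  map_add' _ _ := rfl
  map_smul' _ _ := rfl

theorem Iso.mem_lag {V U : Symp.{u} F} (f : Iso V U) (L : V.OrientedLag) :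
    ∀ l ∈ L.space, f.toLinearEquiv l ∈ (f.lag L).space := fun l hl => ⟨l, hl, rfl⟩

theorem Iso.mem_of_mem_symm_lag {V U : Symp.{u} F} (f : Iso V U) (L : U.OrientedLag) :
    ∀ l ∈ (f.symm.lag L).space, f.toLinearEquiv l ∈ L.space := by
  rintro _ ⟨l, hl, rfl⟩
  have e : f.toLinearEquiv (f.symm.toLinearEquiv l) = l := f.toLinearEquiv.apply_symm_apply l
  exact e.symm ▸ hl

/-- Transport of a system of intertwining morphisms along an isomorphism. -/
def Iso.transport {V U : Symp.{u} F} (f : Iso V U) {ψ : AddChar F ℂ}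
    (K : IntertwiningSystem ψ V) : IntertwiningSystem ψ U := fun M L =>
  { toLinearMap := f.symm.pull ψ M (f.symm.lag M) (f.symm.mem_lag M) ∘ₗ
      (K (f.symm.lag M) (f.symm.lag L)).toLinearMap ∘ₗ
      f.pull ψ (f.symm.lag L) L (f.mem_of_mem_symm_lag L)
    isIntertwining' := fun h => by
      ext w h'
      have e : f.pull ψ (f.symm.lag L) L (f.mem_of_mem_symm_lag L) (modelRep ψ U L h w)
          = modelRep ψ V (f.symm.lag L) (f.symm.heis h)
            (f.pull ψ (f.symm.lag L) L (f.mem_of_mem_symm_lag L) w) := by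
        ext h''
        change w.1 (f.heis h'' * h) = w.1 (f.heis (h'' * f.symm.heis h))
        rw [map_mul, f.heis_heis_symm]
      change (K (f.symm.lag M) (f.symm.lag L) (f.pull ψ (f.symm.lag L) L
          (f.mem_of_mem_symm_lag L) (modelRep ψ U L h w))).1 (f.symm.heis h')
        = (K (f.symm.lag M) (f.symm.lag L) (f.pull ψ (f.symm.lag L) L
          (f.mem_of_mem_symm_lag L) w)).1 (f.symm.heis (h' * h))
      rw [e, (K (f.symm.lag M) (f.symm.lag L)).isIntertwining, map_mul]
      rfl }

theorem IntertwiningSystem.congr {ψ : AddChar F ℂ} {V : Symp.{u} F} (K : IntertwiningSystem ψ V)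
    {M M' L L' : V.OrientedLag} (hM : M = M') (hL : L = L') (w : model ψ V L)
    (w' : model ψ V L') (hw : w.1 = w'.1) : (K M L w).1 = (K M' L' w').1 := by
  subst hM hL
  rw [Subtype.ext hw]

theorem Iso.transport_isCanonical [Fintype F] [DecidableEq F] {V U : Symp.{u} F} (f : Iso V U)
    {ψ : AddChar F ℂ} {K : IntertwiningSystem ψ V} (hK : IsCanonical K) :
    IsCanonical (f.transport K) where
  restriction M L hML w h := by
    have hd : Disjoint (f.symm.lag M).space (f.symm.lag L).space := by
      rw [Submodule.disjoint_def] at hML ⊢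
      intro x hx hx'
      have := hML _ (f.mem_of_mem_symm_lag M x hx) (f.mem_of_mem_symm_lag L x hx')
      simpa using this
    refine (hK.restriction _ _ hd (f.pull ψ (f.symm.lag L) L (f.mem_of_mem_symm_lag L) w)
      (f.symm.heis h)).trans ?_
    congr 1
    · unfold normConst
      rw [f.symm.wedgePairing_lag, f.halfDim_eq]
    · refine finsum_eq_of_bijective
        (fun m => (⟨f.toLinearEquiv m, f.mem_of_mem_symm_lag M m m.2⟩ : M.space)) ⟨?_, ?_⟩ ?_
      · intro a b hab
        exact Subtype.ext (f.toLinearEquiv.injective (congrArg Subtype.val hab))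
      · intro m
        exact ⟨⟨f.symm.toLinearEquiv m, f.symm.mem_lag M m m.2⟩,
          Subtype.ext (f.toLinearEquiv.apply_symm_apply m)⟩
      · intro m
        change w.1 (f.heis (Heis.ofVec (m : V) * f.symm.heis h)) = _
        rw [map_mul, f.heis_heis_symm]
        rfl
  multiplicative N M L := by
    ext w h
    change (K (f.symm.lag N) (f.symm.lag L) _).1 _ = (K (f.symm.lag N) (f.symm.lag M) _).1 _
    rw [hK.multiplicative _ (f.symm.lag M)]
    change (K (f.symm.lag N) (f.symm.lag M) _).1 _ = _
    refine congrFun (K.congr rfl rfl _ _ (funext fun h' => ?_)) _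
    change _ = (K (f.symm.lag M) (f.symm.lag L) _).1 (f.symm.heis (f.heis h'))
    rw [f.heis_symm_heis]
    rfl

/-- The map `H(f) : H(U, ψ) → H(V, ψ)` attached to a morphism `f : V → U`: on a family `(w_L)`,
it is given by `(H(f) w)_L = w_{f(L)} ∘ f`. -/
def Iso.canonicalMap [Fintype F] [DecidableEq F] {V U : Symp.{u} F} (f : Iso V U)
    (ψ : AddChar F ℂ) : canonicalSpace ψ U →ₗ[ℂ] canonicalSpace ψ V where
  toFun w := ⟨fun L => f.pull ψ L (f.lag L) (f.mem_lag L) (w.1 (f.lag L)), fun K hK M L => by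
    have h := w.2 _ (f.transport_isCanonical hK) (f.lag M) (f.lag L)
    ext x
    have hx := congrFun (congrArg Subtype.val h) (f.heis x)
    change (K (f.symm.lag (f.lag M)) (f.symm.lag (f.lag L)) _).1 (f.symm.heis (f.heis x)) = _
      at hx
    rw [f.heis_symm_heis] at hx
    refine Eq.trans (congrFun (K.congr (f.lag_symm_lag M).symm (f.lag_symm_lag L).symm _ _ ?_) x)
      hx
    rfl⟩
  map_add' _ _ := rfl
  map_smul' _ _ := rfl

end Symp

end

noncomputable section

namespace Symp

variable {F : Type v} [Field F]

/-! Write A(M,L) for the normalized averaging map (`averaging`), and let n be half the dimension of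
V. An intertwiner H_L → H_M is determined by one number, the value at 1 of the image of the vector
supported on L times the center (`intertwiningMap_ext`). Identities between intertwiners thus become
identities between numbers.

If P is a common complement of L and M and π : L → M is the projection along P, the number attached
to A(M,P) ∘ A(P,L) is q^(-n), times σ(det π) and the signs of the orientations of L and M, times the
Gauss sum of the symmetric form B(l,l') = -ω(π l, l') on L. Replacing P by P' changes π by an
automorphism g of L that fixes the radical L ∩ M of B. The Gauss sum changes by σ(det g)
(`formGauss_twist`), and so does σ(det π), so the composite does not depend on P
(`averaging_comp_eq`). It is A(M,L) when L and M are transverse, and the identity when L = M.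

A canonical system must equal this composite, which gives uniqueness. For existence,
multiplicativity is clear for three Lagrangians with a common complement. The general case reduces
to this one, because two transverse Lagrangians and any third have a common complement
(`exists_lagrangian_disjoint₃`).

The pairing is the sum of a_L(x,0) b_L(x,0) over x in V. The averaging maps of the dual are adjoint
to those of V (`heisPairing_averaging`), so the sum does not depend on L (`heisPairing_eq`), and
naturality is a change of variables. Complex conjugation exchanges the models of V and of its dual,
so non-degeneracy is the positivity of a sum of squares. -/

theorem addChar_sum {ι : Type*} (ψ : AddChar F ℂ) (s : Finset ι) (f : ι → F) :
    ψ (∑ i ∈ s, f i) = ∏ i ∈ s, ψ (f i) :=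
  map_prod ψ.toMonoidHom (fun i => Multiplicative.ofAdd (f i)) s

theorem sum_addChar_mul [Fintype F] {ψ : AddChar F ℂ} (hψ : ψ ≠ 1) {a : F} (ha : a ≠ 0) :
    ∑ x : F, ψ (a * x) = 0 := by
  have := AddChar.sum_eq_zero_of_ne_one (AddChar.IsPrimitive.of_ne_one hψ ha)
  simpa [AddChar.mulShift_apply] using this

/-- The quadratic character of a finite field, with complex values. -/
def quadChar (F : Type v) [Field F] [Fintype F] [DecidableEq F] : MulChar F ℂ :=
  (quadraticChar F).ringHomComp (Int.castRingHom ℂ)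

/-! ### Quadratic Gauss sums in one variable -/

section Gauss

variable [Fintype F] [DecidableEq F]

theorem quadChar_apply (a : F) : quadChar F a = ((quadraticChar F a : ℤ) : ℂ) := rfl

theorem quadChar_mul_self {a : F} (ha : a ≠ 0) : quadChar F a * quadChar F a = 1 := by
  rw [← sq, quadChar_apply]
  exact_mod_cast quadraticChar_sq_one ha

/-- An element y has 1 + σ(y) square roots; the constant 1 contributes nothing, by orthogonality of
characters. -/
theorem sum_addChar_mul_sq (hF : ringChar F ≠ 2) {ψ : AddChar F ℂ} (hψ : ψ ≠ 1) {a : F}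
    (ha : a ≠ 0) : ∑ x : F, ψ (a * x ^ 2) = quadChar F a * gaussSum (quadChar F) ψ := by
  have h1 : ∑ x : F, ψ (a * x ^ 2) = ∑ y : F, (quadChar F y + 1) * ψ (a * y) := by
    rw [← Finset.sum_fiberwise_of_maps_to (s := Finset.univ) (t := Finset.univ)
      (g := fun x : F => x ^ 2) (fun _ _ => Finset.mem_univ _)]
    refine Finset.sum_congr rfl fun y _ => ?_
    have hc : ((Finset.univ.filter fun x : F => x ^ 2 = y).card : ℂ) = quadChar F y + 1 := by
      have := quadraticChar_card_sqrts hF y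
      rw [Set.toFinset_ofPred] at this
      rw [quadChar_apply]
      exact_mod_cast congrArg (Int.cast : ℤ → ℂ) this
    rw [Finset.sum_congr rfl (g := fun _ => ψ (a * y)) (by
      intro x hx
      rw [(Finset.mem_filter.1 hx).2]), Finset.sum_const, nsmul_eq_mul, hc]
  rw [h1]
  simp only [add_mul, one_mul, Finset.sum_add_distrib, sum_addChar_mul hψ ha, add_zero]
  have h2 := gaussSum_mulShift (quadChar F) ψ (Units.mk0 a ha)
  rw [Units.val_mk0] at h2
  rw [← h2, ← mul_assoc, quadChar_mul_self ha, one_mul]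
  simp [gaussSum, AddChar.mulShift_apply]

theorem sum_addChar_half_mul_sq (hF : ringChar F ≠ 2) {ψ : AddChar F ℂ} (hψ : ψ ≠ 1) {a : F}
    (ha : a ≠ 0) : ∑ x : F, ψ (2⁻¹ * (a * x ^ 2)) = quadChar F a * gaussSum₁ ψ := by
  have h2 : (2⁻¹ : F) ≠ 0 := inv_ne_zero (Ring.two_ne_zero hF)
  simp only [gaussSum₁, sum_addChar_mul_sq hF hψ h2, ← mul_assoc]
  rw [sum_addChar_mul_sq hF hψ (mul_ne_zero h2 ha), map_mul, mul_comm (quadChar F a)]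

theorem quadChar_ne_one (hF : ringChar F ≠ 2) : quadChar F ≠ 1 := by
  intro h
  apply quadraticChar_ne_one hF
  ext a
  have := congrArg (fun χ : MulChar F ℂ => χ a) h
  simp only [quadChar_apply] at this
  rw [MulChar.one_apply a.isUnit] at this ⊢
  exact_mod_cast this

theorem gaussSum₁_sq (hF : ringChar F ≠ 2) {ψ : AddChar F ℂ} (hψ : ψ ≠ 1) :
    gaussSum₁ ψ ^ 2 = quadChar F (-1) * Fintype.card F := by
  have h2 : (2⁻¹ : F) ≠ 0 := inv_ne_zero (Ring.two_ne_zero hF)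
  have hq : (quadChar F).IsQuadratic := (quadraticChar_isQuadratic (F := F)).comp _
  rw [gaussSum₁, sum_addChar_mul_sq hF hψ h2, mul_pow, sq (quadChar F _), quadChar_mul_self h2,
    one_mul, gaussSum_sq (quadChar_ne_one hF) hq (AddChar.IsPrimitive.of_ne_one hψ)]

end Gauss

/-! ### Gauss sums of symmetric bilinear forms -/

section Forms

open LinearMap (BilinForm)

variable {W : Type*} [AddCommGroup W] [Module F W]

/-- The Gauss sum of a bilinear form. -/
def formGauss (ψ : AddChar F ℂ) (B : BilinForm F W) [Fintype W] : ℂ := ∑ w : W, ψ (2⁻¹ * B w w)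

/-- The determinant of a linear map enters the Gram determinants linearly. -/
theorem det_pairing_map {ι U X : Type*} [Fintype ι] [DecidableEq ι] [AddCommGroup U] [Module F U]
    [AddCommGroup X] [Module F X] (B : W →ₗ[F] X →ₗ[F] F) (f : U →ₗ[F] W) (b : Module.Basis ι F U)
    (c : Module.Basis ι F W) (x : ι → X) :
    (Matrix.of fun i j => B (f (b i)) (x j)).det
      = (LinearMap.toMatrix b c f).det * (Matrix.of fun i j => B (c i) (x j)).det := by
  rw [← Matrix.det_transpose (LinearMap.toMatrix b c f), ← Matrix.det_mul]
  congr 1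
  ext i j
  rw [Matrix.mul_apply, Matrix.of_apply]
  conv_lhs => rw [← c.sum_repr (f (b i))]
  simp only [map_sum, map_smul, LinearMap.sum_apply, LinearMap.smul_apply, smul_eq_mul,
    Matrix.transpose_apply, LinearMap.toMatrix_apply, Matrix.of_apply]

theorem iIsOrtho_diag {ι : Type*} [Fintype ι] {B : BilinForm F W} {v : Module.Basis ι F W}
    (hv : B.IsOrthoᵢ v) (w : W) (j : ι) : B w (v j) = v.repr w j * B (v j) (v j) := by
  conv_lhs => rw [← v.sum_repr w]
  simp only [map_sum, map_smul, LinearMap.sum_apply, LinearMap.smul_apply, smul_eq_mul]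
  refine Finset.sum_eq_single j (fun i _ hij => ?_) (fun h => absurd (Finset.mem_univ j) h)
  rw [(LinearMap.isOrthoᵢ_def.1 hv) i j hij, mul_zero]

theorem formGauss_of_iIsOrtho [Fintype F] (ψ : AddChar F ℂ) {ι : Type*} [Fintype ι] [Fintype W]
    {B : BilinForm F W} {v : Module.Basis ι F W} (hv : B.IsOrthoᵢ v) :
    formGauss ψ B = ∏ i, ∑ x : F, ψ (2⁻¹ * (B (v i) (v i) * x ^ 2)) := by
  classical
  rw [Finset.prod_univ_sum, Fintype.piFinset_univ, formGauss]
  refine Fintype.sum_equiv v.equivFun.toEquiv _ _ fun w => ?_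
  rw [← addChar_sum, ← Finset.mul_sum]
  congr 2
  conv_lhs => enter [2]; rw [← v.sum_repr w]
  simp only [map_sum, map_smul, smul_eq_mul]
  refine Finset.sum_congr rfl fun i _ => ?_
  rw [iIsOrtho_diag hv w i]
  simp only [LinearEquiv.coe_toEquiv, Module.Basis.equivFun_apply]
  ring

variable [Fintype F] [DecidableEq F]

/-- In an orthogonal basis the sum factors into one-variable Gauss sums. The Gram determinant in `b`
differs from the one in that basis by the square of a change-of-basis determinant, which σ does not
see. -/
theorem formGauss_eq (hF : ringChar F ≠ 2) {ψ : AddChar F ℂ} (hψ : ψ ≠ 1) [Fintype W] {n : ℕ}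
    {B : BilinForm F W} (hB : B.IsSymm) (b : Module.Basis (Fin n) F W)
    (hd : (Matrix.of fun i j => B (b i) (b j)).det ≠ 0) :
    formGauss ψ B = quadChar F (Matrix.of fun i j => B (b i) (b j)).det * gaussSum₁ ψ ^ n := by
  have : Module.Finite F W := Module.Finite.of_basis b
  have : Invertible (2 : F) := invertibleOfNonzero (Ring.two_ne_zero hF)
  have hB' : LinearMap.IsSymm B := ⟨fun x y => hB.eq x y⟩
  obtain ⟨v, hv⟩ := LinearMap.BilinForm.exists_orthogonal_basis hB'
  have hn : n = Module.finrank F W := by simpa using (Module.finrank_eq_card_basis b).symm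
  subst hn
  have h1 := det_pairing_map B LinearMap.id b v b
  have h2 := det_pairing_map B.flip LinearMap.id b v v
  have h3 : (Matrix.of fun i j => B.flip (v i) (v j)).det = ∏ i, B (v i) (v i) := by
    rw [← Matrix.det_diagonal]
    congr 1
    ext i j
    rcases eq_or_ne i j with rfl | hij
    · simp
    · rw [Matrix.diagonal_apply_ne _ hij]
      exact (LinearMap.isOrthoᵢ_def.1 hv) j i hij.symm
  have h4 : (Matrix.of fun i j => B (v i) (b j)).det
      = (Matrix.of fun i j => B.flip (b i) (v j)).det := by
    rw [← Matrix.det_transpose]; rfl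
  simp only [LinearMap.id_apply] at h1 h2
  rw [h4, h2, h3] at h1
  rw [h1] at hd ⊢
  have hP := left_ne_zero_of_mul hd
  have hD := right_ne_zero_of_mul (right_ne_zero_of_mul hd)
  rw [Finset.prod_ne_zero_iff] at hD
  rw [formGauss_of_iIsOrtho ψ hv, map_mul, map_mul, ← mul_assoc (quadChar F _),
    quadChar_mul_self hP, one_mul, map_prod]
  simp only [fun i => sum_addChar_half_mul_sq hF hψ (hD i (Finset.mem_univ i)),
    Finset.prod_mul_distrib, Finset.prod_const, Finset.card_univ, Fintype.card_fin]

/-- If `B' (g x) y = B x y`, where `g` is the identity on the radical, then the Gauss sums of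
`B` and `B'` differ by the quadratic character of `det g`. -/
theorem formGauss_twist (hF : ringChar F ≠ 2) {ψ : AddChar F ℂ} (hψ : ψ ≠ 1) [Fintype W]
    [Module.Finite F W] {B B' : BilinForm F W} (hB : B.IsSymm) (hB' : B'.IsSymm) (g : W ≃ₗ[F] W)
    (hg : ∀ x y, B' (g x) y = B x y) (hker : ∀ x ∈ LinearMap.ker B, g x = x) :
    formGauss ψ B = quadChar F (LinearMap.det (g : W →ₗ[F] W)) * formGauss ψ B' := by
  classical
  set I := LinearMap.ker B with hI
  have hI' : I ≤ LinearMap.ker B' := fun x hx => by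
    have h : g x = x := hker x hx
    ext y
    rw [← h, hg, LinearMap.mem_ker.1 hx]
  have hI'' : LinearMap.ker B' ≤ I := fun x hx => by
    have e : g.symm x ∈ I := by
      rw [hI, LinearMap.mem_ker]
      ext y
      rw [← hg, g.apply_symm_apply, LinearMap.mem_ker.1 hx]
    have := hker _ e
    rw [g.apply_symm_apply] at this
    rwa [this]
  have hIe : LinearMap.ker B' = I := le_antisymm hI'' hI'
  -- Both forms descend to non-degenerate forms on `W ⧸ I`, where `formGauss_eq` applies.
  have key : ∀ C : BilinForm F W, C.IsSymm → LinearMap.ker C = I →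
      ∃ Q : BilinForm F (W ⧸ I), Q.IsSymm ∧ (∀ x y, Q (I.mkQ x) (I.mkQ y) = C x y) ∧
        LinearMap.ker Q = ⊥ := by
    intro C hC hCI
    have h1 : ∀ x, I ≤ LinearMap.ker (C x) := fun x y hy => by
      rw [← hCI] at hy
      rw [LinearMap.mem_ker, ← hC.eq y x, LinearMap.mem_ker.1 hy]; simp
    let Q : BilinForm F (W ⧸ I) := I.liftQ
      { toFun := fun x => I.liftQ (C x) (h1 x)
        map_add' := fun x y => by
          refine Submodule.linearMap_qext _ (LinearMap.ext fun z => ?_)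
          change C (x + y) z = C x z + C y z
          simp
        map_smul' := fun a x => by
          refine Submodule.linearMap_qext _ (LinearMap.ext fun z => ?_)
          change C (a • x) z = a • C x z
          simp } (fun x hx => by
          rw [← hCI, LinearMap.mem_ker] at hx
          rw [LinearMap.mem_ker]
          refine Submodule.linearMap_qext _ (LinearMap.ext fun z => ?_)
          change C x z = 0
          rw [hx]; simp)
    have hQ : ∀ x y, Q (I.mkQ x) (I.mkQ y) = C x y := fun x y => rfl
    refine ⟨Q, ⟨fun x y => ?_⟩, hQ, ?_⟩
    · obtain ⟨x, rfl⟩ := I.mkQ_surjective x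
      obtain ⟨y, rfl⟩ := I.mkQ_surjective y
      rw [hQ, hQ, hC.eq]
    · rw [LinearMap.ker_eq_bot']
      intro x hx
      obtain ⟨x, rfl⟩ := I.mkQ_surjective x
      rw [Submodule.mkQ_apply, Submodule.Quotient.mk_eq_zero, ← hCI, LinearMap.mem_ker]
      ext y
      rw [← hQ, hx]; simp
  obtain ⟨Q, hQs, hQ, hQk⟩ := key B hB rfl
  obtain ⟨Q', hQs', hQ', hQk'⟩ := key B' hB' hIe
  have : Fintype (W ⧸ I) := Fintype.ofFinite _
  have hfib : ∀ (C : BilinForm F W) (R : BilinForm F (W ⧸ I)),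
      (∀ x y, R (I.mkQ x) (I.mkQ y) = C x y) → formGauss ψ C = Nat.card I * formGauss ψ R := by
    intro C R hR
    rw [formGauss, formGauss, Finset.mul_sum, ← Finset.sum_fiberwise_of_maps_to
      (s := Finset.univ) (t := Finset.univ) (g := I.mkQ) (fun _ _ => Finset.mem_univ _)]
    refine Finset.sum_congr rfl fun y _ => ?_
    obtain ⟨y, rfl⟩ := I.mkQ_surjective y
    rw [Finset.sum_congr rfl (g := fun _ => ψ (2⁻¹ * R (I.mkQ y) (I.mkQ y))) (by
      intro x hx
      rw [← (Finset.mem_filter.1 hx).2, hR]), Finset.sum_const, nsmul_eq_mul]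
    congr 2
    rw [← Fintype.card_subtype, ← Nat.card_eq_fintype_card]
    refine Nat.card_congr ⟨fun x => ⟨x - y, ?_⟩, fun i => ⟨i + y, by simp⟩, fun x => ?_, fun i => ?_⟩
    · exact (Submodule.Quotient.eq I).1 x.2
    · exact Subtype.ext (by simp)
    · exact Subtype.ext (by simp)
  rw [hfib B Q hQ, hfib B' Q' hQ']
  have hle : I ≤ I.comap (g : W →ₗ[F] W) := fun x hx => by
    rw [Submodule.mem_comap, LinearEquiv.coe_coe, hker x hx]; exact hx
  set gb := I.mapQ I (g : W →ₗ[F] W) hle with hgb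
  -- `g` is the identity on `I`, so its determinant is that of the induced map on the quotient.
  have hdet : LinearMap.det (g : W →ₗ[F] W) = LinearMap.det gb := by
    rw [LinearMap.det_eq_det_mul_det I (g : W →ₗ[F] W) hle]
    have : (g : W →ₗ[F] W).restrict hle = LinearMap.id := by
      ext x
      simpa using hker x x.2
    rw [this, LinearMap.det_id, one_mul]
  let b := Module.finBasis F (W ⧸ I)
  have hnd : ∀ R : BilinForm F (W ⧸ I), LinearMap.ker R = ⊥ → R.IsSymm →
      (Matrix.of fun i j => R (b i) (b j)).det ≠ 0 := by
    intro R hR hRs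
    have : R.Nondegenerate := by
      have h1 : R.SeparatingLeft := LinearMap.separatingLeft_iff_ker_eq_bot.2 hR
      refine ⟨h1, fun y hy => h1 y fun x => ?_⟩
      rw [← hRs.eq]; exact hy x
    have h := (LinearMap.BilinForm.nondegenerate_iff_det_ne_zero b).1 this
    convert h using 2
    ext i j
    simp [LinearMap.BilinForm.toMatrix_apply]
  have hQg : ∀ x y, Q' (gb x) y = Q x y := by
    intro x y
    obtain ⟨x, rfl⟩ := I.mkQ_surjective x
    obtain ⟨y, rfl⟩ := I.mkQ_surjective y
    rw [hQ, ← hg, ← hQ']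
    rfl
  have hG := det_pairing_map Q' gb b b b
  simp only [hQg, LinearMap.det_toMatrix] at hG
  rw [formGauss_eq hF hψ hQs b (hnd Q hQk hQs), formGauss_eq hF hψ hQs' b (hnd Q' hQk' hQs'),
    hG, map_mul, hdet]
  ring

end Forms

/-! ### Lagrangian subspaces and their common complements -/

section Lagrangian

open Module (finrank)

variable {V : Symp.{u} F} {L M : Submodule F V}

theorem form_swap (x y : V) : V.form x y = -V.form y x := (LinearMap.IsAlt.neg V.isAlt y x).symm

theorem form_eq_zero (hL : V.form.orthogonal L = L) {x y : V} (hx : x ∈ L) (hy : y ∈ L) :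
    V.form x y = 0 := by
  rw [← hL] at hy
  exact hy x hx

theorem mem_of_form_eq_zero (hL : V.form.orthogonal L = L) {x : V}
    (h : ∀ y ∈ L, V.form y x = 0) : x ∈ L := by
  rw [← hL]
  exact fun y hy => h y hy

theorem finrank_eq_two_mul (hL : V.form.orthogonal L = L) : finrank F V = 2 * V.halfDim := by
  have h := LinearMap.BilinForm.finrank_orthogonal V.nondegenerate L
  rw [hL] at h
  have h' := Submodule.finrank_le L
  unfold halfDim
  omega

theorem isCompl_of_disjoint (hL : V.form.orthogonal L = L) (hM : V.form.orthogonal M = M)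
    (h : Disjoint L M) : IsCompl L M := by
  refine ⟨h, codisjoint_iff.2 (Submodule.eq_top_of_finrank_eq ?_)⟩
  have h1 := Submodule.finrank_sup_add_finrank_inf_eq L M
  rw [h.eq_bot, finrank_bot, finrank_lagrangian hL, finrank_lagrangian hM] at h1
  rw [finrank_eq_two_mul hL]
  omega

theorem orthogonal_eq_of_isotropic (hV : finrank F V = 2 * V.halfDim)
    (hL : finrank F L = V.halfDim) (h : ∀ x ∈ L, ∀ y ∈ L, V.form x y = 0) :
    V.form.orthogonal L = L := by
  symm
  apply Submodule.eq_of_le_of_finrank_eq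
  · exact fun y hy x hx => h x hx y hy
  · have := LinearMap.BilinForm.finrank_orthogonal V.nondegenerate L
    omega

/-- A Lagrangian subspace is dual to any complement. -/
theorem exists_dualEquiv (hL : V.form.orthogonal L = L) {C : Submodule F V} (h : IsCompl L C) :
    ∃ e : L ≃ₗ[F] Module.Dual F C, ∀ l c, e l c = V.form l c := by
  let f : L →ₗ[F] Module.Dual F C := V.form.compl₁₂ L.subtype C.subtype
  have hf : Function.Injective f := by
    rw [← LinearMap.ker_eq_bot, LinearMap.ker_eq_bot']
    intro l hl
    apply Subtype.ext
    refine V.nondegenerate.1 l fun y => ?_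
    obtain ⟨a, ha, c, hc, rfl⟩ := Submodule.mem_sup.1 (h.sup_eq_top ▸ Submodule.mem_top : y ∈ L ⊔ C)
    rw [map_add, form_eq_zero hL l.2 ha, zero_add]
    exact DFunLike.congr_fun hl ⟨c, hc⟩
  have hd : finrank F L = finrank F (Module.Dual F C) := by
    rw [Subspace.dual_finrank_eq]
    have := Submodule.finrank_add_eq_of_isCompl h
    rw [finrank_lagrangian hL] at *
    rw [finrank_eq_two_mul hL] at this
    omega
  exact ⟨LinearEquiv.ofInjectiveOfFinrankEq f hf hd, fun l c => rfl⟩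

theorem finrank_range_add {C : Submodule F V} (h : Disjoint C L) (T : C →ₗ[F] L) :
    finrank F (LinearMap.range (C.subtype + L.subtype ∘ₗ T)) = finrank F C := by
  apply LinearMap.finrank_range_of_inj
  rw [← LinearMap.ker_eq_bot, LinearMap.ker_eq_bot']
  intro c hc
  have hc' : (c : V) + (T c : V) = 0 := hc
  apply Subtype.ext
  refine Submodule.disjoint_def.1 h c c.2 ?_
  rw [eq_neg_of_add_eq_zero_left hc']
  exact L.neg_mem (T c).2

/-- An arbitrary complement C is corrected to a graph {c + T c} with T : C → L. As ω makes L the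
dual of C, T can be chosen with ω(T c, c') = -ω(c, c')/2, and the two correction terms cancel ω on
C. -/
theorem exists_isCompl_lagrangian (h2 : (2 : F) ≠ 0) (hL : V.form.orthogonal L = L) :
    ∃ M : Submodule F V, V.form.orthogonal M = M ∧ Disjoint L M := by
  obtain ⟨C, hC⟩ := Submodule.exists_isCompl L
  obtain ⟨e, he⟩ := exists_dualEquiv hL hC
  let T : C →ₗ[F] L := e.symm.toLinearMap ∘ₗ
    ((-(2⁻¹ : F)) • V.form.compl₁₂ C.subtype C.subtype)
  have hT : ∀ c c' : C, V.form (T c) c' = -2⁻¹ * V.form c c' := by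
    intro c c'
    rw [← he]
    simp [T]
  have hCd : finrank F C = V.halfDim := by
    have := Submodule.finrank_add_eq_of_isCompl hC
    rw [finrank_lagrangian hL, finrank_eq_two_mul hL] at this
    omega
  refine ⟨LinearMap.range (C.subtype + L.subtype ∘ₗ T), ?_, ?_⟩
  · apply orthogonal_eq_of_isotropic (finrank_eq_two_mul hL)
    · rw [finrank_range_add hC.disjoint.symm, hCd]
    · rintro _ ⟨c, rfl⟩ _ ⟨c', rfl⟩
      change V.form ((c : V) + T c) ((c' : V) + T c') = 0
      simp only [map_add, LinearMap.add_apply]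
      rw [form_eq_zero hL (T c).2 (T c').2, hT, form_swap (c : V) (T c' : V), hT,
        form_swap (c' : V) c]
      field_simp
      ring
  · rw [Submodule.disjoint_def]
    rintro _ hx ⟨c, rfl⟩
    change (c : V) + T c ∈ L at hx
    have hc : (c : V) = 0 := Submodule.disjoint_def.1 hC.disjoint c
      ((L.add_mem_iff_left (T c).2).1 hx) c.2
    have : c = 0 := Subtype.ext hc
    rw [this, map_zero]

theorem exists_ne_zero_ne (h2 : (2 : F) ≠ 0) (b : F) : ∃ x : F, x ≠ 0 ∧ x ≠ b := by
  by_cases hb : b = 1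
  · refine ⟨-1, neg_ne_zero.2 one_ne_zero, fun h => h2 ?_⟩
    rw [hb] at h
    linear_combination -h
  · exact ⟨1, one_ne_zero, fun h => hb h.symm⟩

/-- Over a field with at least three elements, any symmetric form is a difference of two
non-degenerate ones. -/
theorem exists_symm_form (h2 : (2 : F) ≠ 0) {W : Type*} [AddCommGroup W] [Module F W]
    [Module.Finite F W] (B : LinearMap.BilinForm F W) (hB : B.IsSymm) :
    ∃ X : LinearMap.BilinForm F W, X.IsSymm ∧ (∀ w, (∀ w', X w w' = 0) → w = 0) ∧
      ∀ w, (∀ w', X w w' = B w w') → w = 0 := by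
  have : Invertible (2 : F) := invertibleOfNonzero h2
  have hB' : LinearMap.IsSymm B := ⟨fun x y => hB.eq x y⟩
  obtain ⟨v, hv⟩ := LinearMap.BilinForm.exists_orthogonal_basis hB'
  -- `X` is diagonal in an orthogonal basis of `B`; its entries avoid 0 and those of `B`, so `X` and
  -- `X - B` are both non-degenerate.
  choose x hx0 hxb using fun i => exists_ne_zero_ne h2 (B (v i) (v i))
  let X : LinearMap.BilinForm F W := ∑ i, x i • (LinearMap.mul F F).compl₁₂ (v.coord i) (v.coord i)
  have hX : ∀ w w', X w w' = ∑ i, x i * (v.repr w i * v.repr w' i) := by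
    intro w w'
    simp [X]
  have hXv : ∀ w j, X w (v j) = x j * v.repr w j := by
    intro w j
    rw [hX, Finset.sum_eq_single j]
    · simp
    · intro i _ hij
      simp [Finsupp.single_eq_of_ne hij]
    · simp
  refine ⟨X, ⟨fun w w' => ?_⟩, fun w hw => ?_, fun w hw => ?_⟩
  · rw [hX, hX]
    exact Finset.sum_congr rfl fun i _ => by ring
  · apply v.repr.injective
    ext j
    have := hw (v j)
    rw [hXv] at this
    simpa [hx0 j] using this
  · apply v.repr.injective
    ext j
    have := hw (v j)
    rw [hXv, iIsOrtho_diag hv, mul_comm, ← sub_eq_zero, ← mul_sub] at this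
    simpa [sub_ne_zero.2 (hxb j)] using this

/-- A symmetric form on a subspace `W` can be avoided on `W` by a non-degenerate symmetric form
on the whole space. -/
theorem exists_symm_form_of_subspace (h2 : (2 : F) ≠ 0) {E : Type*} [AddCommGroup E] [Module F E]
    [Module.Finite F E] (W : Submodule F E) (B : LinearMap.BilinForm F W) (hB : B.IsSymm) :
    ∃ X : LinearMap.BilinForm F E, X.IsSymm ∧ (∀ w, (∀ w', X w w' = 0) → w = 0) ∧
      ∀ w : W, (∀ w' : W, X w w' = B w w') → w = 0 := by
  obtain ⟨C, hC⟩ := Submodule.exists_isCompl W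
  obtain ⟨X, hX, hX0, hXB⟩ := exists_symm_form h2 B hB
  -- Only some non-degenerate symmetric form on the complement is needed; applying the lemma to 0
  -- supplies one.
  obtain ⟨Y, hY, hY0, -⟩ := exists_symm_form h2 (0 : LinearMap.BilinForm F C)
    ⟨fun x y => by simp⟩
  let e := Submodule.prodEquivOfIsCompl W C hC
  let p : E →ₗ[F] W := LinearMap.fst F W C ∘ₗ e.symm.toLinearMap
  let q : E →ₗ[F] C := LinearMap.snd F W C ∘ₗ e.symm.toLinearMap
  have hp : ∀ w : W, p w = w := fun w => by simp [p, e]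
  have hq : ∀ w : W, q w = 0 := fun w => by simp [q, e]
  have hp' : ∀ c : C, p c = 0 := fun w => by simp [p, e]
  have hq' : ∀ c : C, q c = c := fun w => by simp [q, e]
  refine ⟨X.compl₁₂ p p + Y.compl₁₂ q q, ⟨fun x y => ?_⟩, fun x hx => ?_, fun w hw => ?_⟩
  · simp [hX.eq (p x), hY.eq (q x)]
  · have h1 : p x = 0 := hX0 _ fun w => by simpa [hp, hq] using hx w
    have h2 : q x = 0 := hY0 _ fun c => by simpa [hp', hq'] using hx c
    apply e.symm.injective
    rw [map_zero]
    exact Prod.ext h1 h2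
  · exact hXB w fun w' => by simpa [hp, hq] using hw w'

/-- If `L` and `M` are transverse Lagrangians, then any Lagrangian `N` has a common Lagrangian
complement with `L` and `M`. -/
theorem exists_lagrangian_disjoint₃ (h2 : (2 : F) ≠ 0) (hL : V.form.orthogonal L = L)
    (hM : V.form.orthogonal M = M) (hLM : Disjoint L M) {N : Submodule F V}
    (hN : V.form.orthogonal N = N) :
    ∃ P : Submodule F V, V.form.orthogonal P = P ∧ Disjoint P L ∧ Disjoint P M ∧
      Disjoint P N := by
  have hc := isCompl_of_disjoint hL hM hLM
  obtain ⟨e, he⟩ := exists_dualEquiv hM hc.symm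
  let p : V →ₗ[F] L := LinearMap.fst F L M ∘ₗ (Submodule.prodEquivOfIsCompl L M hc).symm.toLinearMap
  have hp : ∀ x, x - p x ∈ M := by
    intro x
    obtain ⟨⟨l, m⟩, rfl⟩ := (Submodule.prodEquivOfIsCompl L M hc).surjective x
    simp [p]
  have hpl : ∀ l ∈ L, (p l : V) = l := fun l hl => by
    have h1 := hp l
    have h3 := Submodule.disjoint_def.1 hLM _ (L.sub_mem hl (p l).2) h1
    exact (sub_eq_zero.1 h3).symm
  have hpm : ∀ m ∈ M, p m = 0 := fun m hm => by
    have h1 := hp m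
    exact Subtype.ext (Submodule.disjoint_def.1 hLM _ (p m).2 (by
      simpa using M.sub_mem hm h1))
  let pN : N →ₗ[F] L := p ∘ₗ N.subtype
  obtain ⟨s, hs⟩ := LinearMap.exists_rightInverse_of_surjective pN.rangeRestrict
    pN.range_rangeRestrict
  have hs' : ∀ w, p (s w : V) = w := fun w => congrArg Subtype.val (DFunLike.congr_fun hs w)
  -- Over its image in `L`, the Lagrangian `N` looks like the graph of the form `B`; `B` is
  -- symmetric because `L`, `M` and `N` are all isotropic.
  let B : LinearMap.BilinForm F (LinearMap.range pN) :=
    V.form.compl₁₂ (L.subtype ∘ₗ (LinearMap.range pN).subtype) (N.subtype ∘ₗ s)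
  have hBd : ∀ w w', B w w' = V.form ((w : L) : V) (s w' : V) := fun _ _ => rfl
  have hpair : ∀ (l : V) (_ : l ∈ L) (x : V), V.form l x = V.form l (x - p x) := by
    intro l hl x
    rw [map_sub, form_eq_zero hL hl (p x).2, sub_zero]
  have hB : B.IsSymm := by
    refine ⟨fun w w' => ?_⟩
    have h0 : V.form (s w : V) (s w') = 0 := form_eq_zero hN (s w).2 (s w').2
    have h1 : V.form ((s w : V) - p (s w : V)) ((s w' : V) - p (s w' : V)) = 0 :=
      form_eq_zero hM (hp _) (hp _)
    have h3 : V.form (p (s w : V) : V) (p (s w' : V) : V) = 0 :=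
      form_eq_zero hL (p _).2 (p _).2
    have h4 := form_swap (s w : V) (p (s w' : V) : V)
    rw [hBd, hBd, ← hs' w, ← hs' w']
    simp only [map_sub, LinearMap.sub_apply] at h1
    rw [hs' w, hs' w'] at *
    linear_combination -h1 + h0 + h3 - h4
  obtain ⟨X, hX, hX0, hXB⟩ := exists_symm_form_of_subspace h2 _ B hB
  -- The complement is the graph of `φ`, the map with ω(l', φ l) = X(l, l'). Symmetry of `X` makes
  -- it Lagrangian, non-degeneracy makes it transverse to `L`, and it meets `N` only where `X` and
  -- `B` agree.
  let φ : L →ₗ[F] M := -(e.symm.toLinearMap ∘ₗ X)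
  have hφ : ∀ l l' : L, V.form (l' : V) (φ l : V) = X l l' := by
    intro l l'
    rw [form_swap, ← he]
    simp [φ]
  refine ⟨LinearMap.range (L.subtype + M.subtype ∘ₗ φ), ?_, ?_, ?_, ?_⟩
  · apply orthogonal_eq_of_isotropic (finrank_eq_two_mul hL)
    · rw [finrank_range_add hLM, finrank_lagrangian hL]
    · rintro _ ⟨l, rfl⟩ _ ⟨l', rfl⟩
      change V.form ((l : V) + φ l) ((l' : V) + φ l') = 0
      simp only [map_add, LinearMap.add_apply]
      rw [form_eq_zero hL l.2 l'.2, form_eq_zero hM (φ l).2 (φ l').2, hφ, form_swap _ (l' : V), hφ,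
        hX.eq]
      ring
  · rw [Submodule.disjoint_def]
    rintro _ ⟨l, rfl⟩ hl
    change (l : V) + φ l ∈ L at hl
    have h1 : (φ l : V) = 0 := Submodule.disjoint_def.1 hLM _
      ((L.add_mem_iff_right l.2).1 hl) (φ l).2
    have : l = 0 := hX0 l fun w => by rw [← hφ, h1, map_zero]
    rw [this, map_zero]
  · rw [Submodule.disjoint_def]
    rintro _ ⟨l, rfl⟩ hl
    change (l : V) + φ l ∈ M at hl
    have : l = 0 := Subtype.ext (Submodule.disjoint_def.1 hLM _ l.2
      ((M.add_mem_iff_left (φ l).2).1 hl))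
    rw [this, map_zero]
  · rw [Submodule.disjoint_def]
    rintro _ ⟨l, rfl⟩ hl
    change (l : V) + φ l ∈ N at hl
    have hpl' : p ((l : V) + φ l) = l := by
      rw [map_add, hpm _ (φ l).2, add_zero]
      exact Subtype.ext (hpl _ l.2)
    have hlW : l ∈ LinearMap.range pN := ⟨⟨_, hl⟩, hpl'⟩
    have : (⟨l, hlW⟩ : LinearMap.range pN) = 0 := hXB _ fun w => by
      have h0 : V.form ((l : V) + φ l) (s w : V) = 0 := form_eq_zero hN hl (s w).2
      have h1 : V.form (φ l : V) (s w : V) = V.form (φ l : V) ((w : L) : V) := by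
        rw [← hs' w, ← sub_eq_zero, ← map_sub]
        exact form_eq_zero hM (φ l).2 (hp _)
      rw [map_add, LinearMap.add_apply, h1, form_swap (φ l : V), hφ] at h0
      rw [hBd]
      linear_combination -h0
    have : l = 0 := congrArg Subtype.val this
    rw [this, map_zero]

/-- `L` and `M` may intersect, so a Lagrangian complement of `L` completes the transverse pair and
`M` plays the third Lagrangian. -/
theorem exists_lagrangian_disjoint₂ (h2 : (2 : F) ≠ 0) (hL : V.form.orthogonal L = L)
    (hM : V.form.orthogonal M = M) :
    ∃ P : Submodule F V, V.form.orthogonal P = P ∧ Disjoint P L ∧ Disjoint P M := by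
  obtain ⟨N, hN, hLN⟩ := exists_isCompl_lagrangian h2 hL
  obtain ⟨P, hP, hPL, -, hPM⟩ := exists_lagrangian_disjoint₃ h2 hL hN hLN hM
  exact ⟨P, hP, hPL, hPM⟩

/-- The projection of a complement of `P` to another one, along `P`. -/
def transfer {P : Submodule F V} (hL : IsCompl P L) (hM : IsCompl P M) : L ≃ₗ[F] M :=
  (Submodule.quotientEquivOfIsCompl P L hL).symm.trans (Submodule.quotientEquivOfIsCompl P M hM)

theorem transfer_sub_mem {P : Submodule F V} (hL : IsCompl P L) (hM : IsCompl P M) (l : L) :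
    (transfer hL hM l : V) - l ∈ P := by
  rw [← Submodule.Quotient.eq]
  have h : P.mkQ (transfer hL hM l : V) = P.mkQ l := by
    rw [Submodule.mkQ_apply, Submodule.mkQ_apply, ← Submodule.quotientEquivOfIsCompl_symm_apply P M hM,
      ← Submodule.quotientEquivOfIsCompl_symm_apply P L hL]
    exact (Submodule.quotientEquivOfIsCompl P M hM).symm_apply_apply _
  exact h

end Lagrangian

/-! ### Orientations and Gram determinants -/

section Orientation

open Module (finrank Basis)

theorem ιMulti_basis_ne_zero {W : Type*} [AddCommGroup W] [Module F W] {n : ℕ}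
    (b : Basis (Fin n) F W) : exteriorPower.ιMulti F n b ≠ 0 := by
  intro h
  have := exteriorPower.pairingDual_ιMulti_ιMulti (fun i => b.coord i) b
  rw [h, map_zero] at this
  have e : (Matrix.of fun i j => b.coord j (b i)) = (1 : Matrix (Fin n) (Fin n) F) := by
    ext i j
    simp [Matrix.one_apply, Finsupp.single_apply]
  rw [e, Matrix.det_one] at this
  exact zero_ne_one this

variable {V : Symp.{u} F}

/-- Every Lagrangian subspace has an orientation. -/
theorem exists_orientedLag {P : Submodule F V} (hP : V.form.orthogonal P = P) :
    ∃ L : V.OrientedLag, L.space = P := by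
  let b := Module.finBasis F P
  let o := exteriorPower.ιMulti F (finrank F P) b
  refine ⟨⟨P, hP, ExteriorAlgebra.map P.subtype o, ⟨o, o.2, rfl⟩, fun h => ?_⟩, rfl⟩
  rw [← coe_exteriorPower_map] at h
  refine ιMulti_basis_ne_zero b (exteriorPower.map_injective_field P.injective_subtype ?_)
  rw [map_zero]
  exact Subtype.ext h

namespace OrientedLag

/-- A basis of a Lagrangian subspace. -/
def basis (L : V.OrientedLag) : Basis (Fin V.halfDim) F L.space :=
  Module.finBasisOfFinrankEq F L.space (finrank_lagrangian L.lagrangian)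

/-- The top exterior power of a Lagrangian is a line; this reduces pairings of orientations to Gram
determinants of fixed bases. -/
theorem exists_orientVec_eq (L : V.OrientedLag) :
    ∃ c : F, c ≠ 0 ∧
      L.orientVec = c • exteriorPower.ιMulti F V.halfDim fun i => (L.basis i : V) := by
  have hm : L.orient ∈ (⋀[F]^V.halfDim L.space).map
      (ExteriorAlgebra.map L.space.subtype).toLinearMap := by
    rw [← finrank_lagrangian L.lagrangian]
    exact L.orient_mem
  obtain ⟨o, ho, h⟩ := hm
  have h1 : finrank F (⋀[F]^V.halfDim L.space) = 1 := by
    rw [exteriorPower.finrank_eq, finrank_lagrangian L.lagrangian, Nat.choose_self]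
  obtain ⟨c, hc⟩ := exists_smul_eq_of_finrank_eq_one h1 (ιMulti_basis_ne_zero L.basis) ⟨o, ho⟩
  have h2 : L.orientVec = exteriorPower.map V.halfDim L.space.subtype ⟨o, ho⟩ := by
    apply Subtype.ext
    rw [coe_exteriorPower_map]
    exact h.symm
  refine ⟨c, ?_, ?_⟩
  · rintro rfl
    rw [zero_smul] at hc
    rw [← hc, map_zero] at h2
    exact L.orient_ne_zero (congrArg Subtype.val h2)
  · rw [h2, ← hc, map_smul, exteriorPower.map_apply_ιMulti]
    rfl

/-- The coefficient of the orientation with respect to the chosen basis. -/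
def coeff (L : V.OrientedLag) : F := L.exists_orientVec_eq.choose

theorem coeff_ne_zero (L : V.OrientedLag) : L.coeff ≠ 0 := L.exists_orientVec_eq.choose_spec.1

theorem orientVec_eq (L : V.OrientedLag) :
    L.orientVec = L.coeff • exteriorPower.ιMulti F V.halfDim fun i => (L.basis i : V) :=
  L.exists_orientVec_eq.choose_spec.2

/-- The Gram matrix of the symplectic form between the bases of two Lagrangians. -/
def gram (L M : V.OrientedLag) : Matrix (Fin V.halfDim) (Fin V.halfDim) F :=
  Matrix.of fun i j => V.form (L.basis i : V) (M.basis j : V)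

theorem gram_swap (L M : V.OrientedLag) : M.gram L = -(L.gram M).transpose := by
  ext i j
  exact form_swap _ _

theorem det_gram_swap (L M : V.OrientedLag) :
    (M.gram L).det = (-1) ^ V.halfDim * (L.gram M).det := by
  rw [gram_swap, Matrix.det_neg, Matrix.det_transpose, Fintype.card_fin]

theorem det_gram_ne_zero {L M : V.OrientedLag} (h : Disjoint L.space M.space) :
    (L.gram M).det ≠ 0 := by
  intro h0
  obtain ⟨x, hx, hxg⟩ := Matrix.exists_vecMul_eq_zero_iff.2 h0
  obtain ⟨e, he⟩ := exists_dualEquiv L.lagrangian (isCompl_of_disjoint L.lagrangian M.lagrangian h)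
  have h1 : e (∑ i, x i • L.basis i) = 0 := by
    apply M.basis.ext
    intro j
    rw [he]
    have := congrFun hxg j
    simpa [Matrix.vecMul, dotProduct, gram] using this
  have h2 : ∑ i, x i • L.basis i = 0 := e.map_eq_zero_iff.1 h1
  exact hx (funext (Fintype.linearIndependent_iff.1 L.basis.linearIndependent x h2))

/-- The pairing of orientations, normalized to be a Gram determinant. -/
def pairing (L M : V.OrientedLag) : F :=
  (-1) ^ (V.halfDim.choose 2) * V.wedgePairing L.orientVec M.orientVec

theorem pairing_eq (L M : V.OrientedLag) :
    L.pairing M = L.coeff * M.coeff * (L.gram M).det := by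
  rw [pairing, wedgePairing, ← mul_assoc, ← mul_pow, neg_one_mul, neg_neg, one_pow, one_mul,
    L.orientVec_eq, M.orientVec_eq]
  simp only [map_smul, LinearMap.smul_apply, smul_eq_mul, exteriorPower.map_apply_ιMulti]
  rw [Function.comp_def, exteriorPower.pairingDual_ιMulti_ιMulti, ← Matrix.det_transpose,
    ← mul_assoc, mul_comm M.coeff]
  rfl

end OrientedLag

end Orientation

/-! ### Vectors in the models H_L -/

section Models

@[simp] theorem Heis.mul_vec {V : Symp.{u} F} (a b : Heis V) : (a * b).vec = a.vec + b.vec := rfl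
@[simp] theorem Heis.mul_ctr {V : Symp.{u} F} (a b : Heis V) :
    (a * b).ctr = a.ctr + b.ctr + 2⁻¹ * V.form a.vec b.vec := rfl
@[simp] theorem Heis.one_vec {V : Symp.{u} F} : (1 : Heis V).vec = 0 := rfl
@[simp] theorem Heis.one_ctr {V : Symp.{u} F} : (1 : Heis V).ctr = 0 := rfl
@[simp] theorem Heis.inv_vec {V : Symp.{u} F} (a : Heis V) : a⁻¹.vec = -a.vec := rfl
@[simp] theorem Heis.inv_ctr {V : Symp.{u} F} (a : Heis V) : a⁻¹.ctr = -a.ctr := rfl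
@[simp] theorem Heis.ofVec_vec {V : Symp.{u} F} (x : V) : (Heis.ofVec x).vec = x := rfl
@[simp] theorem Heis.ofVec_ctr {V : Symp.{u} F} (x : V) : (Heis.ofVec x).ctr = 0 := rfl
@[simp] theorem Heis.ofCtr_vec {V : Symp.{u} F} (z : F) : (Heis.ofCtr z : Heis V).vec = 0 := rfl
@[simp] theorem Heis.ofCtr_ctr {V : Symp.{u} F} (z : F) : (Heis.ofCtr z : Heis V).ctr = z := rfl

variable {V : Symp.{u} F} {ψ : AddChar F ℂ}

theorem Heis.eq_ofCtr_mul_ofVec (h : Heis V) : h = Heis.ofCtr h.ctr * Heis.ofVec h.vec := by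
  ext <;> simp

theorem Heis.ofVec_mul_ofCtr_mul (x : V) (z : F) (h : Heis V) :
    Heis.ofVec x * (Heis.ofCtr z * h) = Heis.ofCtr z * (Heis.ofVec x * h) := by
  ext
  · simp
  · simp; ring

theorem Heis.ofVec_mul_ofVec (x y : V) :
    Heis.ofVec x * Heis.ofVec y = Heis.ofCtr (2⁻¹ * V.form x y) * Heis.ofVec (x + y) := by
  ext <;> simp

theorem model_apply {L : V.OrientedLag} (f : model ψ V L) (h : Heis V) :
    f.1 h = ψ h.ctr * f.1 (Heis.ofVec h.vec) := by
  conv_lhs => rw [h.eq_ofCtr_mul_ofVec]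
  exact f.2.1 _ _

open Classical in
/-- The vector of `H_L` supported on `L` times the center. -/
def vacuum (ψ : AddChar F ℂ) (L : V.OrientedLag) : model ψ V L :=
  ⟨fun h => if h.vec ∈ L.space then ψ h.ctr else 0, fun z h => by
    simp only [Heis.mul_vec, Heis.ofCtr_vec, zero_add, Heis.mul_ctr, Heis.ofCtr_ctr, map_zero,
      LinearMap.zero_apply, mul_zero, add_zero, mul_ite, AddChar.map_add_eq_mul],
  fun l hl h => by
    simp only [Heis.mul_vec, Heis.ofVec_vec, L.space.add_mem_iff_right hl, Heis.mul_ctr,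
      Heis.ofVec_ctr, zero_add]
    split_ifs with hh
    · rw [form_eq_zero L.lagrangian hl hh, mul_zero, add_zero]
    · rfl⟩

theorem vacuum_of_mem {L : V.OrientedLag} {h : Heis V} (hh : h.vec ∈ L.space) :
    (vacuum ψ L).1 h = ψ h.ctr := if_pos hh

theorem vacuum_of_not_mem {L : V.OrientedLag} {h : Heis V} (hh : h.vec ∉ L.space) :
    (vacuum ψ L).1 h = 0 := if_neg hh

theorem modelRep_vacuum {L : V.OrientedLag} {l : V} (hl : l ∈ L.space) :
    modelRep ψ V L (Heis.ofVec l) (vacuum ψ L) = vacuum ψ L := by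
  ext h
  change (vacuum ψ L).1 (h * Heis.ofVec l) = (vacuum ψ L).1 h
  by_cases hh : h.vec ∈ L.space
  · rw [vacuum_of_mem hh, vacuum_of_mem (by simpa using L.space.add_mem hh hl)]
    simp [form_eq_zero L.lagrangian hh hl]
  · rw [vacuum_of_not_mem hh, vacuum_of_not_mem]
    rwa [Heis.mul_vec, Heis.ofVec_vec, L.space.add_mem_iff_left hl]

theorem orthogonal_inf_lagrangian {L M : Submodule F V} (hL : V.form.orthogonal L = L)
    (hM : V.form.orthogonal M = M) : V.form.orthogonal (L ⊓ M) = L ⊔ M := by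
  have h : V.form.orthogonal (L ⊔ M) = L ⊓ M := by
    apply le_antisymm
    · refine le_inf ?_ ?_
      · conv_rhs => rw [← hL]
        exact LinearMap.BilinForm.orthogonal_le le_sup_left
      · conv_rhs => rw [← hM]
        exact LinearMap.BilinForm.orthogonal_le le_sup_right
    · rintro x ⟨hx, hx'⟩ y hy
      obtain ⟨a, ha, b, hb, rfl⟩ := Submodule.mem_sup.1 hy
      change V.form (a + b) x = 0
      rw [map_add, LinearMap.add_apply, form_eq_zero hL ha hx, form_eq_zero hM hb hx', add_zero]
  rw [← h]
  exact LinearMap.BilinForm.orthogonal_orthogonal V.nondegenerate V.isAlt.isRefl _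

/-- This is multiplicity one. Invariance under `M` on the left and `L` on the right determines `g`
on M + L from its value at 1. Off M + L = (M ∩ L)^⊥, moving a suitable element of M ∩ L from left to
right multiplies the value by a number other than 1, so `g` vanishes. -/
theorem eq_zero_of_right_invariant (h2F : (2 : F) ≠ 0) (hψ : ψ ≠ 1) {L M : V.OrientedLag} (g : model ψ V M)
    (hg : ∀ l ∈ L.space, ∀ h, g.1 (h * Heis.ofVec l) = g.1 h) (h1 : g.1 1 = 0) : g = 0 := by
  ext h
  change g.1 h = 0
  rw [model_apply]
  refine mul_eq_zero_of_right _ ?_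
  generalize h.vec = x
  by_cases hx : x ∈ M.space ⊔ L.space
  · obtain ⟨m, hm, l, hl, rfl⟩ := Submodule.mem_sup.1 hx
    have h2 : g.1 (Heis.ofVec m * Heis.ofVec l) = 0 := by
      rw [hg l hl, ← mul_one (Heis.ofVec m), g.2.2 m hm, h1]
    rw [Heis.ofVec_mul_ofVec, g.2.1] at h2
    exact (mul_eq_zero.1 h2).resolve_left (ψ.val_isUnit _).ne_zero
  · rw [← orthogonal_inf_lagrangian M.lagrangian L.lagrangian,
      LinearMap.BilinForm.mem_orthogonal_iff] at hx
    push Not at hx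
    obtain ⟨i, ⟨hiM, hiL⟩, hi⟩ := hx
    have hi0 : V.form i x ≠ 0 := hi
    obtain ⟨t, ht⟩ := AddChar.ne_one_iff.1 hψ
    -- Scaled so that ω(j, x) = t, where ψ(t) ≠ 1.
    set j : V := (t / V.form i x) • i with hj
    have hjx : V.form j x = t := by
      rw [hj, map_smul, LinearMap.smul_apply, smul_eq_mul, div_mul_cancel₀ _ hi0]
    have e : Heis.ofVec j * Heis.ofVec x = Heis.ofCtr t * (Heis.ofVec x * Heis.ofVec j) := by
      have hxj := form_swap x j
      rw [hjx] at hxj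
      ext
      · simp [add_comm]
      · simp only [Heis.mul_ctr, Heis.ofVec_ctr, Heis.ofVec_vec, Heis.ofCtr_ctr, Heis.ofCtr_vec,
          hjx, hxj, map_zero, LinearMap.zero_apply]
        field_simp
        ring
    have h2 := g.2.2 j (M.space.smul_mem _ hiM) (Heis.ofVec x)
    rw [e, g.2.1, hg j (L.space.smul_mem _ hiL)] at h2
    by_contra h3
    exact ht (mul_right_cancel₀ h3 (h2.trans (one_mul _).symm))

end Models

/-! ### Projection between Lagrangians along a common complement -/

section Along

variable {V : Symp.{u} F} {L M P : V.OrientedLag}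

/-- The isomorphism of `L` with `M` along a common complement `P`. -/
def OrientedLag.along (L M P : V.OrientedLag) (hL : Disjoint P.space L.space)
    (hM : Disjoint P.space M.space) : L.space ≃ₗ[F] M.space :=
  transfer (isCompl_of_disjoint P.lagrangian L.lagrangian hL)
    (isCompl_of_disjoint P.lagrangian M.lagrangian hM)

theorem along_sub_mem (hL : Disjoint P.space L.space) (hM : Disjoint P.space M.space)
    (l : L.space) : (L.along M P hL hM l : V) - l ∈ P.space :=
  transfer_sub_mem _ _ l

/-- The symmetric form on `L` attached to `M` and to a common complement `P`. -/
def OrientedLag.alongForm (L M P : V.OrientedLag) (hL : Disjoint P.space L.space)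
    (hM : Disjoint P.space M.space) : LinearMap.BilinForm F L.space :=
  -(V.form.compl₁₂ (M.space.subtype ∘ₗ (L.along M P hL hM).toLinearMap) L.space.subtype)

theorem alongForm_apply (hL : Disjoint P.space L.space) (hM : Disjoint P.space M.space)
    (l l' : L.space) : L.alongForm M P hL hM l l' = -V.form (L.along M P hL hM l : V) l' := rfl

end Along

/-! ### Averaging operators and their matrix coefficients -/

section Averaging

variable [Fintype F] {V : Symp.{u} F} {ψ : AddChar F ℂ}

instance fintypeCarrier (V : Symp.{u} F) : Fintype V :=
  haveI : Finite V := Module.finite_of_finite F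
  Fintype.ofFinite V

instance fintypeSubmodule (V : Symp.{u} F) (L : Submodule F V) : Fintype L := Fintype.ofFinite L

theorem card_lagrangian (L : V.OrientedLag) :
    Fintype.card L.space = Fintype.card F ^ V.halfDim := by
  rw [Module.card_eq_pow_finrank (K := F), finrank_lagrangian L.lagrangian]

theorem card_ne_zero : (Fintype.card F : ℂ) ≠ 0 := Nat.cast_ne_zero.2 Fintype.card_ne_zero

/-- The translates of the vacuum vector span the model. -/
theorem sum_vacuum (L : V.OrientedLag) (f : model ψ V L) :
    (Fintype.card L.space : ℂ) • f
      = ∑ x : V, f.1 (Heis.ofVec x) • modelRep ψ V L (Heis.ofVec x)⁻¹ (vacuum ψ L) := by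
  classical
  ext h
  have e : (∑ x : V, f.1 (Heis.ofVec x) • modelRep ψ V L (Heis.ofVec x)⁻¹ (vacuum ψ L)).1 h
      = ∑ x : V, f.1 (Heis.ofVec x) * (vacuum ψ L).1 (h * (Heis.ofVec x)⁻¹) := by
    rw [Submodule.coe_sum, Finset.sum_apply]
    rfl
  rw [e]
  -- The nonzero terms are those with x in the coset of `L` through `h.vec`, and each of them equals
  -- `f.1 h`.
  have e1 : ∀ x : V, f.1 (Heis.ofVec x) * (vacuum ψ L).1 (h * (Heis.ofVec x)⁻¹)
      = if h.vec - x ∈ L.space then f.1 h else 0 := by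
    intro x
    have hv : (h * (Heis.ofVec x)⁻¹).vec = h.vec - x := by simp [sub_eq_add_neg]
    split_ifs with hx
    · rw [vacuum_of_mem (by rwa [hv])]
      conv_rhs => rw [← inv_mul_cancel_right h (Heis.ofVec x),
        Heis.eq_ofCtr_mul_ofVec (h * (Heis.ofVec x)⁻¹), mul_assoc, f.2.1, hv, f.2.2 _ hx]
      rw [mul_comm]
    · rw [vacuum_of_not_mem (by rwa [hv]), mul_zero]
  simp only [e1]
  rw [← Finset.sum_filter, Finset.sum_const, nsmul_eq_mul]
  change (Fintype.card L.space : ℂ) * f.1 h = _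
  congr 2
  rw [← Fintype.card_subtype]
  refine Fintype.card_congr ⟨fun l => ⟨h.vec - l, by simp⟩, fun x => ⟨h.vec - x, x.2⟩,
    fun l => Subtype.ext (by simp), fun x => Subtype.ext (by simp)⟩

/-- Intertwining maps are determined by one matrix coefficient. -/
theorem intertwiningMap_ext (h2 : (2 : F) ≠ 0) (hψ : ψ ≠ 1) {L M : V.OrientedLag}
    {S T : (modelRep ψ V L).IntertwiningMap (modelRep ψ V M)}
    (h : (S (vacuum ψ L)).1 1 = (T (vacuum ψ L)).1 1) : S = T := by
  -- The vacuum is fixed by `L`, so the difference of its images is right invariant under `L`.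
  have h0 : S (vacuum ψ L) - T (vacuum ψ L) = 0 := by
    refine eq_zero_of_right_invariant h2 hψ (L := L) _ (fun l hl x => ?_) ?_
    · have hS := S.isIntertwining _ _ (Heis.ofVec l) (vacuum ψ L)
      have hT := T.isIntertwining _ _ (Heis.ofVec l) (vacuum ψ L)
      rw [modelRep_vacuum hl] at hS hT
      have hS' := congrFun (congrArg Subtype.val hS) x
      have hT' := congrFun (congrArg Subtype.val hT) x
      change (S (vacuum ψ L)).1 (x * Heis.ofVec l) - (T (vacuum ψ L)).1 (x * Heis.ofVec l)
        = (S (vacuum ψ L)).1 x - (T (vacuum ψ L)).1 x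
      rw [hS', hT']
      rfl
    · change (S (vacuum ψ L)).1 1 - (T (vacuum ψ L)).1 1 = 0
      rw [h, sub_self]
  rw [sub_eq_zero] at h0
  apply Representation.IntertwiningMap.ext
  ext1 f
  change S f = T f
  have hc : (Fintype.card L.space : ℂ) ≠ 0 := Nat.cast_ne_zero.2 Fintype.card_ne_zero
  have key : (Fintype.card L.space : ℂ) • S f = (Fintype.card L.space : ℂ) • T f := by
    rw [← map_smul, ← map_smul, sum_vacuum, map_sum, map_sum]
    refine Finset.sum_congr rfl fun x _ => ?_
    rw [map_smul, map_smul, S.isIntertwining, T.isIntertwining, h0]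
  exact smul_right_injective _ hc key

variable [DecidableEq F]

/-- Averaging over a Lagrangian subspace, with the canonical normalization. -/
def averaging (ψ : AddChar F ℂ) (M L : V.OrientedLag) :
    (modelRep ψ V L).IntertwiningMap (modelRep ψ V M) where
  toFun f := ⟨fun h => normConst ψ V M L * ∑ m : M.space, f.1 (Heis.ofVec (m : V) * h),
    fun z h => by
      simp only [Heis.ofVec_mul_ofCtr_mul, f.2.1, ← Finset.mul_sum]
      ring,
    fun m hm h => by
      refine congrArg (normConst ψ V M L * ·) ?_
      refine Fintype.sum_equiv (Equiv.addRight (⟨m, hm⟩ : M.space)) _ _ fun x => ?_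
      rw [← mul_assoc, Heis.ofVec_mul_ofVec, form_eq_zero M.lagrangian x.2 hm, mul_zero,
        show (Heis.ofCtr 0 : Heis V) = 1 from rfl, one_mul]
      rfl⟩
  map_add' f g := by
    ext h
    change _ * ∑ m : M.space, (f.1 _ + g.1 _) = _ * ∑ m : M.space, f.1 _ + _ * ∑ m : M.space, g.1 _
    rw [Finset.sum_add_distrib, mul_add]
  map_smul' a f := by
    ext h
    change _ * ∑ m : M.space, (a * f.1 _) = a * (_ * ∑ m : M.space, f.1 _)
    rw [← Finset.mul_sum, mul_left_comm]
  isIntertwining' g := by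
    ext f h
    change _ * ∑ m : M.space, f.1 (Heis.ofVec (m : V) * h * g)
      = _ * ∑ m : M.space, f.1 (Heis.ofVec (m : V) * (h * g))
    simp only [mul_assoc]

theorem averaging_apply (M L : V.OrientedLag) (f : model ψ V L) (h : Heis V) :
    (averaging ψ M L f).1 h = normConst ψ V M L * ∑ m : M.space, f.1 (Heis.ofVec (m : V) * h) :=
  rfl

theorem normConst_eq (M L : V.OrientedLag) :
    normConst ψ V M L = (gaussSum₁ ψ / Fintype.card F) ^ V.halfDim * quadChar F (L.pairing M) :=
  rfl

theorem averaging_vacuum (M L : V.OrientedLag) :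
    (averaging ψ M L (vacuum ψ L)).1 1
      = normConst ψ V M L * ∑ m : M.space, (vacuum ψ L).1 (Heis.ofVec (m : V)) := by
  rw [averaging_apply]
  simp only [mul_one]

theorem averaging_vacuum_of_disjoint {M L : V.OrientedLag} (h : Disjoint M.space L.space) :
    (averaging ψ M L (vacuum ψ L)).1 1 = normConst ψ V M L := by
  rw [averaging_vacuum, Finset.sum_eq_single 0]
  · rw [vacuum_of_mem (by simp)]
    simp
  · intro m _ hm
    refine vacuum_of_not_mem fun hmL => hm (Subtype.ext ?_)
    exact Submodule.disjoint_def.1 h m m.2 hmL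
  · simp

variable {L M P : V.OrientedLag}

/-- Parametrize M by m = π l. The vacuum sees only the element p = l - π l of P, and the product of
(p,0) and (m,0) has central part ω(p,m)/2 = -ω(π l, l)/2, half the value of the form at l. -/
theorem averaging_averaging_vacuum (hL : Disjoint P.space L.space)
    (hM : Disjoint P.space M.space) :
    (averaging ψ M P (averaging ψ P L (vacuum ψ L))).1 1
      = normConst ψ V M P * normConst ψ V P L * formGauss ψ (L.alongForm M P hL hM) := by
  rw [averaging_apply]
  simp only [averaging_apply, mul_one]
  rw [← Finset.mul_sum, ← mul_assoc]
  congr 1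
  refine (Fintype.sum_equiv (L.along M P hL hM).toEquiv _ _ fun l => ?_).symm
  have hd := along_sub_mem hL hM l
  rw [Finset.sum_eq_single (-⟨_, hd⟩ : P.space)]
  · have hv : (Heis.ofVec (((-⟨_, hd⟩ : P.space)) : V) *
        Heis.ofVec (((L.along M P hL hM).toEquiv l : M.space) : V)).vec = l := by
      simp
    rw [vacuum_of_mem (by rw [hv]; exact l.2)]
    congr 1
    have h0 : V.form (L.along M P hL hM l : V) (L.along M P hL hM l) = 0 :=
      V.isAlt.self_eq_zero _
    rw [alongForm_apply]
    simp [form_swap (l : V), h0]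
  · intro p _ hp
    refine vacuum_of_not_mem fun hmem => hp ?_
    have h1 : (p : V) + (L.along M P hL hM l : V) ∈ L.space := hmem
    have h2 : (p : V) + ((L.along M P hL hM l : V) - l) ∈ L.space := by
      rw [← add_sub_assoc]
      exact L.space.sub_mem h1 l.2
    have h3 := Submodule.disjoint_def.1 hL _ (P.space.add_mem p.2 hd) h2
    exact eq_neg_of_add_eq_zero_left (Subtype.ext h3)
  · simp

end Averaging

/-! ### The canonical system of intertwining maps -/

section Canonical

variable {V : Symp.{u} F} {ψ : AddChar F ℂ} {L M P P' : V.OrientedLag}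

/-- Expand ω(π x - x, π y - y) = 0, which holds because P is isotropic. -/
theorem alongForm_isSymm (hL : Disjoint P.space L.space) (hM : Disjoint P.space M.space) :
    LinearMap.BilinForm.IsSymm (L.alongForm M P hL hM) := by
  refine ⟨fun x y => ?_⟩
  have h1 : V.form (L.along M P hL hM x : V) (L.along M P hL hM y) = 0 :=
    form_eq_zero M.lagrangian (Subtype.prop _) (Subtype.prop _)
  have h2 : V.form (x : V) y = 0 := form_eq_zero L.lagrangian x.2 y.2
  have h3 := form_eq_zero P.lagrangian (along_sub_mem hL hM x) (along_sub_mem hL hM y)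
  have h4 := form_swap (L.along M P hL hM y : V) x
  simp only [map_sub, LinearMap.sub_apply, h1, h2] at h3
  rw [alongForm_apply, alongForm_apply]
  linear_combination h3 + h4

theorem along_eq_of_mem (hL : Disjoint P.space L.space) (hM : Disjoint P.space M.space)
    {x : L.space} (hx : (x : V) ∈ M.space) : (L.along M P hL hM x : V) = x :=
  sub_eq_zero.1 (Submodule.disjoint_def.1 hM _ (along_sub_mem hL hM x)
    (M.space.sub_mem (Subtype.prop _) hx))

/-- If π x is orthogonal to L it lies in L, so π x - x lies in P ∩ L = 0. The radical of the form is
therefore in L ∩ M, where every projection is the identity. -/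
theorem along_mem_of_alongForm_eq_zero (hL : Disjoint P.space L.space)
    (hM : Disjoint P.space M.space) {x : L.space} (hx : L.alongForm M P hL hM x = 0) :
    (x : V) ∈ M.space := by
  have h1 : (L.along M P hL hM x : V) ∈ L.space := by
    refine mem_of_form_eq_zero L.lagrangian fun y hy => ?_
    rw [form_swap]
    exact DFunLike.congr_fun hx ⟨y, hy⟩
  have h2 : (L.along M P hL hM x : V) = x := sub_eq_zero.1 (Submodule.disjoint_def.1 hL _
    (along_sub_mem hL hM x) (L.space.sub_mem h1 x.2))
  rw [← h2]
  exact Subtype.prop _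

/-- The matrix of the projection of `L` to `M` along `P`. -/
def OrientedLag.alongMatrix (L M P : V.OrientedLag) (hL : Disjoint P.space L.space)
    (hM : Disjoint P.space M.space) : Matrix (Fin V.halfDim) (Fin V.halfDim) F :=
  LinearMap.toMatrix L.basis M.basis (L.along M P hL hM).toLinearMap

/-- An element of P pairs equally with l and π l, since these differ by an element of P. -/
theorem det_gram_along (hL : Disjoint P.space L.space) (hM : Disjoint P.space M.space) :
    (P.gram L).det = (L.alongMatrix M P hL hM).det * (P.gram M).det := by
  have h := det_pairing_map (V.form.flip ∘ₗ M.space.subtype) (L.along M P hL hM).toLinearMap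
    L.basis M.basis (fun i => (P.basis i : V))
  rw [← Matrix.det_transpose (P.gram M), ← Matrix.det_transpose (P.gram L)]
  refine Eq.trans (congrArg Matrix.det ?_) h
  ext i j
  change V.form (P.basis j : V) (L.basis i : V) = V.form (P.basis j : V) (L.along M P hL hM _ : V)
  have h1 := form_eq_zero P.lagrangian (P.basis j).2 (along_sub_mem hL hM (L.basis i))
  rw [map_sub, sub_eq_zero] at h1
  exact h1.symm

theorem det_alongMatrix_ne_zero (hL : Disjoint P.space L.space) (hM : Disjoint P.space M.space) :
    (L.alongMatrix M P hL hM).det ≠ 0 := by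
  have h := OrientedLag.det_gram_ne_zero hL
  rw [det_gram_along hL hM] at h
  exact left_ne_zero_of_mul h

theorem det_alongForm (hL : Disjoint P.space L.space) (hM : Disjoint P.space M.space) :
    (Matrix.of fun i j => L.alongForm M P hL hM (L.basis i) (L.basis j)).det
      = (L.alongMatrix M P hL hM).det * (L.gram M).det := by
  have h := det_pairing_map (-(V.form ∘ₗ M.space.subtype)) (L.along M P hL hM).toLinearMap
    L.basis M.basis (fun i => (L.basis i : V))
  rw [← Matrix.det_transpose (L.gram M)]
  refine Eq.trans (congrArg Matrix.det rfl) (h.trans ?_)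
  congr 2
  ext i j
  exact (form_swap _ _).symm

theorem exists_orientedLag_disjoint (h2 : (2 : F) ≠ 0) (L M : V.OrientedLag) :
    ∃ P : V.OrientedLag, Disjoint P.space L.space ∧ Disjoint P.space M.space := by
  obtain ⟨P, hP, hL, hM⟩ := exists_lagrangian_disjoint₂ h2 L.lagrangian M.lagrangian
  obtain ⟨P, rfl⟩ := exists_orientedLag hP
  exact ⟨P, hL, hM⟩

variable [Fintype F] [DecidableEq F]

theorem gaussSum₁_div_sq (hF : ringChar F ≠ 2) (hψ : ψ ≠ 1) :
    (gaussSum₁ ψ / Fintype.card F) ^ 2 = quadChar F (-1) * (Fintype.card F : ℂ)⁻¹ := by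
  rw [div_pow, gaussSum₁_sq hF hψ]
  field_simp [card_ne_zero (F := F)]

/-- The factor σ(-1)^n from G₁² cancels the sign of the swap in `det_gram_swap`. All other data of P
enter squared, except for det π. -/
theorem normConst_mul_normConst (hF : ringChar F ≠ 2) (hψ : ψ ≠ 1)
    (hL : Disjoint P.space L.space) (hM : Disjoint P.space M.space) :
    normConst ψ V M P * normConst ψ V P L = ((Fintype.card F : ℂ) ^ V.halfDim)⁻¹ *
      quadChar F (L.coeff * M.coeff * (L.alongMatrix M P hL hM).det) := by
  rw [normConst_eq, normConst_eq, mul_mul_mul_comm, ← mul_pow, ← sq, gaussSum₁_div_sq hF hψ,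
    ← map_mul, OrientedLag.pairing_eq, OrientedLag.pairing_eq, OrientedLag.det_gram_swap P L,
    det_gram_along hL hM, mul_pow, ← map_pow, inv_pow]
  have h1 : (-1 : F) ^ V.halfDim ≠ 0 := pow_ne_zero _ (by simp)
  have h2 := quadChar_mul_self (mul_ne_zero (mul_ne_zero P.coeff_ne_zero h1)
    (OrientedLag.det_gram_ne_zero hM))
  simp only [map_mul] at h2 ⊢
  linear_combination (((Fintype.card F : ℂ) ^ V.halfDim)⁻¹ * (quadChar F L.coeff *
    quadChar F M.coeff * quadChar F (L.alongMatrix M P hL hM).det)) * h2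

theorem averaging_comp_vacuum (hF : ringChar F ≠ 2) (hψ : ψ ≠ 1)
    (hL : Disjoint P.space L.space) (hM : Disjoint P.space M.space) :
    ((averaging ψ M P).comp (averaging ψ P L) (vacuum ψ L)).1 1
      = ((Fintype.card F : ℂ) ^ V.halfDim)⁻¹ *
        quadChar F (L.coeff * M.coeff * (L.alongMatrix M P hL hM).det) *
        formGauss ψ (L.alongForm M P hL hM) := by
  rw [← normConst_mul_normConst hF hψ]
  exact averaging_averaging_vacuum hL hM

/-- The composition of two averaging maps does not depend on the intermediate Lagrangian. -/
theorem averaging_comp_eq (hF : ringChar F ≠ 2) (hψ : ψ ≠ 1)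
    (hL : Disjoint P.space L.space) (hM : Disjoint P.space M.space)
    (hL' : Disjoint P'.space L.space) (hM' : Disjoint P'.space M.space) :
    (averaging ψ M P).comp (averaging ψ P L) = (averaging ψ M P').comp (averaging ψ P' L) := by
  apply intertwiningMap_ext (Ring.two_ne_zero hF) hψ
  rw [averaging_comp_vacuum hF hψ hL hM, averaging_comp_vacuum hF hψ hL' hM']
  -- By its definition g carries one form to the other; σ(det g) then appears twice, from the Gauss
  -- sum and from the determinant of the projection, and squares to 1.
  let g : L.space ≃ₗ[F] L.space := (L.along M P hL hM).trans (L.along M P' hL' hM').symm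
  have hg : ∀ x, L.along M P' hL' hM' (g x) = L.along M P hL hM x := fun x =>
    (L.along M P' hL' hM').apply_symm_apply _
  have h1 := formGauss_twist hF hψ (alongForm_isSymm hL hM) (alongForm_isSymm hL' hM') g
    (fun x y => by rw [alongForm_apply, alongForm_apply, hg]) (fun x hx => by
      have hxM := along_mem_of_alongForm_eq_zero hL hM hx
      apply (L.along M P' hL' hM').injective
      rw [hg]
      exact Subtype.ext ((along_eq_of_mem hL hM hxM).trans (along_eq_of_mem hL' hM' hxM).symm))
  have h2 : L.alongMatrix M P hL hM
      = L.alongMatrix M P' hL' hM' * LinearMap.toMatrix L.basis L.basis g.toLinearMap := by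
    rw [OrientedLag.alongMatrix, OrientedLag.alongMatrix,
      ← LinearMap.toMatrix_comp L.basis L.basis M.basis]
    congr 1
    ext x
    exact congrArg Subtype.val (hg x).symm
  have h3 := quadChar_mul_self g.isUnit_det'.ne_zero
  rw [h1, h2, Matrix.det_mul, LinearMap.det_toMatrix]
  simp only [map_mul]
  linear_combination (((Fintype.card F : ℂ) ^ V.halfDim)⁻¹ * (quadChar F L.coeff *
    quadChar F M.coeff * quadChar F (L.alongMatrix M P' hL' hM').det) *
    formGauss ψ (L.alongForm M P' hL' hM')) * h3

/-- The form is now non-degenerate, with determinant det π times the Gram determinant of L and M.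
The two factors σ(det π) cancel, leaving the normalization of the direct averaging map. -/
theorem averaging_comp_of_disjoint (hF : ringChar F ≠ 2) (hψ : ψ ≠ 1)
    (hL : Disjoint P.space L.space) (hM : Disjoint P.space M.space)
    (hML : Disjoint M.space L.space) :
    (averaging ψ M P).comp (averaging ψ P L) = averaging ψ M L := by
  apply intertwiningMap_ext (Ring.two_ne_zero hF) hψ
  have hd := det_alongMatrix_ne_zero hL hM
  rw [averaging_comp_vacuum hF hψ hL hM, averaging_vacuum_of_disjoint hML,
    formGauss_eq hF hψ (alongForm_isSymm hL hM) L.basis (by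
      rw [det_alongForm]
      exact mul_ne_zero hd (OrientedLag.det_gram_ne_zero hML.symm)),
    det_alongForm, normConst_eq, OrientedLag.pairing_eq, div_pow]
  have h3 := quadChar_mul_self hd
  simp only [map_mul]
  linear_combination (((Fintype.card F : ℂ) ^ V.halfDim)⁻¹ * gaussSum₁ ψ ^ V.halfDim *
    (quadChar F L.coeff * quadChar F M.coeff * quadChar F (L.gram M).det)) * h3

/-- Here π is the identity and the form is 0, so its Gauss sum is the cardinality of L, which
cancels q^(-n). -/
theorem averaging_comp_self (hF : ringChar F ≠ 2) (hψ : ψ ≠ 1)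
    (hL : Disjoint P.space L.space) :
    (averaging ψ L P).comp (averaging ψ P L)
      = Representation.IntertwiningMap.id (modelRep ψ V L) := by
  apply intertwiningMap_ext (Ring.two_ne_zero hF) hψ
  have ha : ∀ x, L.along L P hL hL x = x := fun x => Subtype.ext (along_eq_of_mem hL hL x.2)
  have hm : L.alongMatrix L P hL hL = 1 := by
    rw [OrientedLag.alongMatrix, ← LinearMap.toMatrix_id L.basis]
    congr 1
    ext x
    exact congrArg Subtype.val (ha x)
  have hf : formGauss ψ (L.alongForm L P hL hL) = (Fintype.card F : ℂ) ^ V.halfDim := by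
    rw [formGauss, ← Nat.cast_pow, ← card_lagrangian L, Finset.sum_congr rfl (g := fun _ => 1)]
    · simp
    · intro x _
      rw [alongForm_apply, ha, form_eq_zero L.lagrangian x.2 x.2]
      simp
  rw [averaging_comp_vacuum hF hψ hL hL, hf, hm, Matrix.det_one, mul_one, map_mul,
    quadChar_mul_self L.coeff_ne_zero, mul_one, inv_mul_cancel₀ (pow_ne_zero _ card_ne_zero)]
  change 1 = (vacuum ψ L).1 1
  rw [vacuum_of_mem (by simp)]
  simp

theorem IsCanonical.eq_averaging {K : IntertwiningSystem ψ V} (hK : IsCanonical K)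
    (h : Disjoint M.space L.space) : K M L = averaging ψ M L := by
  apply Representation.IntertwiningMap.ext
  ext f x
  change (K M L f).1 x = _
  rw [hK.restriction M L h, finsum_eq_sum_of_fintype]
  rfl

theorem IsCanonical.eq_averaging_comp {K : IntertwiningSystem ψ V} (hK : IsCanonical K)
    (hL : Disjoint P.space L.space) (hM : Disjoint P.space M.space) :
    K M L = (averaging ψ M P).comp (averaging ψ P L) := by
  rw [hK.multiplicative M P L, hK.eq_averaging hL, hK.eq_averaging hM.symm]

theorem exists_isCanonical (hF : ringChar F ≠ 2) (hψ : ψ ≠ 1) (V : Symp.{u} F) :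
    ∃ K : IntertwiningSystem ψ V, IsCanonical K := by
  have h2 := Ring.two_ne_zero hF
  choose Q hQL hQM using exists_orientedLag_disjoint (V := V) h2
  let K : IntertwiningSystem ψ V := fun M L =>
    (averaging ψ M (Q L M)).comp (averaging ψ (Q L M) L)
  have hK : ∀ {M L P : V.OrientedLag}, Disjoint P.space L.space → Disjoint P.space M.space →
      K M L = (averaging ψ M P).comp (averaging ψ P L) := fun hL hM =>
    averaging_comp_eq hF hψ (hQL _ _) (hQM _ _) hL hM
  have hK' : ∀ {M L : V.OrientedLag}, Disjoint M.space L.space → K M L = averaging ψ M L :=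
    fun h => averaging_comp_of_disjoint hF hψ (hQL _ _) (hQM _ _) h
  -- multiplicativity, if there is a common complement
  have h3 : ∀ {N M L P : V.OrientedLag}, Disjoint P.space L.space → Disjoint P.space M.space →
      Disjoint P.space N.space → K N L = (K N M).comp (K M L) := by
    intro N M L P hL hM hN
    rw [hK hL hN, hK hM hN, hK hL hM]
    ext f x
    change _ = (averaging ψ N P (((averaging ψ P M).comp (averaging ψ M P))
      (averaging ψ P L f))).1 x
    rw [averaging_comp_self hF hψ hM.symm]
    rfl
  have h3' : ∀ {L M : V.OrientedLag} (N : V.OrientedLag), Disjoint L.space M.space →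
      ∃ P : V.OrientedLag, Disjoint P.space L.space ∧ Disjoint P.space M.space ∧
        Disjoint P.space N.space := by
    intro L M N h
    obtain ⟨P, hP, hL, hM, hN⟩ := exists_lagrangian_disjoint₃ h2 L.lagrangian M.lagrangian h
      N.lagrangian
    obtain ⟨P, rfl⟩ := exists_orientedLag hP
    exact ⟨P, hL, hM, hN⟩
  refine ⟨K, fun M L h f x => ?_, fun N M L => ?_⟩
  · rw [hK' h, finsum_eq_sum_of_fintype]
    rfl
  -- The three Lagrangians may lack a common complement. Factor `K M L` through Q = `Q L M`,
  -- transverse to `L` and `M`; the triples (L, Q, N) and (M, Q, N) each contain a transverse pair,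
  -- so `h3` applies to both.
  · have hL := hQL L M
    have hM := hQM L M
    obtain ⟨R, hR1, hR2, hR3⟩ := h3' N hL
    obtain ⟨S, hS1, hS2, hS3⟩ := h3' N hM
    have e : K M L = (K M (Q L M)).comp (K (Q L M) L) := by rw [hK' hM.symm, hK' hL]
    rw [h3 hR2 hR1 hR3, h3 hS1 hS2 hS3, e]
    rfl

end Canonical

/-! ### The symplectic dual and the pairing -/

section Dual

variable {V : Symp.{u} F} {ψ : AddChar F ℂ}

/-- A maximal isotropic subspace is Lagrangian: adjoining a vector orthogonal to it keeps it
isotropic. -/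
theorem nonempty_orientedLag (V : Symp.{u} F) : Nonempty V.OrientedLag := by
  obtain ⟨L, hL, hmax⟩ := set_has_maximal_iff_noetherian.2 (inferInstance : IsNoetherian F V)
    {L : Submodule F V | ∀ x ∈ L, ∀ y ∈ L, V.form x y = 0} ⟨⊥, by
      intro x hx y _
      rw [(Submodule.mem_bot F).1 hx]
      simp⟩
  have hlag : V.form.orthogonal L = L := by
    refine le_antisymm (fun x hx => ?_) (fun y hy x hx => hL x hx y hy)
    by_contra hxL
    refine hmax (L ⊔ Submodule.span F {x}) ?_ ?_
    · intro y hy z hz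
      obtain ⟨l, hl, s, hs, rfl⟩ := Submodule.mem_sup.1 hy
      obtain ⟨l', hl', s', hs', rfl⟩ := Submodule.mem_sup.1 hz
      obtain ⟨c, rfl⟩ := Submodule.mem_span_singleton.1 hs
      obtain ⟨c', rfl⟩ := Submodule.mem_span_singleton.1 hs'
      have h1 : V.form l x = 0 := hx l hl
      have h2 : V.form x l' = 0 := by
        rw [form_swap, show V.form l' x = 0 from hx l' hl', neg_zero]
      have h3 : V.form x x = 0 := V.isAlt.self_eq_zero x
      simp [hL l hl l' hl', h1, h2, h3]
    · refine lt_of_le_of_ne le_sup_left fun h => hxL ?_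
      rw [h]
      exact Submodule.mem_sup_right (Submodule.mem_span_singleton_self x)
  obtain ⟨N, -⟩ := exists_orientedLag hlag
  exact ⟨N⟩

/-- An oriented Lagrangian subspace, as an oriented Lagrangian subspace of the dual. -/
def OrientedLag.dual (L : V.OrientedLag) : V.dual.OrientedLag where
  space := L.space
  lagrangian := by
    conv_rhs => rw [← L.lagrangian]
    ext x
    exact forall₂_congr fun y _ => (neg_eq_zero : -(V.form y x) = 0 ↔ V.form y x = 0)
  orient := L.orient
  orient_mem := L.orient_mem
  orient_ne_zero := L.orient_ne_zero

theorem exteriorPower_map_neg {W W' : Type*} [AddCommGroup W] [Module F W] [AddCommGroup W']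
    [Module F W'] (g : W →ₗ[F] W') (n : ℕ) :
    exteriorPower.map n (-g) = (-1 : F) ^ n • exteriorPower.map n g := by
  apply exteriorPower.linearMap_ext
  ext1 m
  have h := (exteriorPower.ιMulti F n (M := W')).toMultilinearMap.map_smul_univ
    (fun _ => (-1 : F)) (g ∘ m)
  simp only [Finset.prod_const, Finset.card_univ, Fintype.card_fin] at h
  simp only [LinearMap.compAlternatingMap_apply, LinearMap.smul_apply,
    exteriorPower.map_apply_ιMulti]
  refine Eq.trans (congrArg _ ?_) h
  ext i
  simp

/-- Negating ω and exchanging the arguments each multiply the n × n determinant by (-1)^n. -/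
theorem OrientedLag.dual_pairing_dual (L M : V.OrientedLag) :
    L.dual.pairing M.dual = M.pairing L := by
  have h : L.dual.pairing M.dual = (-1) ^ V.halfDim * L.pairing M := by
    change (-1) ^ (V.halfDim.choose 2) * ((-1) ^ (V.halfDim.choose 2) *
      exteriorPower.pairingDual F V V.halfDim (exteriorPower.map V.halfDim (-V.form) L.orientVec)
        M.orientVec) = (-1) ^ V.halfDim * ((-1) ^ (V.halfDim.choose 2) *
          ((-1) ^ (V.halfDim.choose 2) * exteriorPower.pairingDual F V V.halfDim
            (exteriorPower.map V.halfDim V.form L.orientVec) M.orientVec))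
    rw [exteriorPower_map_neg]
    simp only [LinearMap.smul_apply, map_smul, smul_eq_mul]
    ring
  rw [h, pairing_eq, pairing_eq, det_gram_swap L M]
  ring

theorem model_eq_zero {L : V.OrientedLag} {f : model ψ V L}
    (h : ∀ x : V, f.1 (Heis.ofVec x) = 0) : f = 0 := by
  ext x
  change f.1 x = 0
  rw [model_apply, h, mul_zero]

theorem eq_zero_of_sum_star_mul {α : Type*} [Fintype α] {c : α → ℂ} (h : ∑ x, star (c x) * c x = 0)
    (x : α) : c x = 0 := by
  have h1 : ∑ x, ‖c x‖ ^ 2 = 0 := by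
    have e : ∀ x, star (c x) * c x = ((‖c x‖ ^ 2 : ℝ) : ℂ) := fun x => by
      rw [Complex.star_def, Complex.conj_mul', Complex.ofReal_pow]
    simp only [e] at h
    exact_mod_cast h
  have := (Finset.sum_eq_zero_iff_of_nonneg (fun x _ => sq_nonneg ‖c x‖)).1 h1 x (Finset.mem_univ x)
  simpa using this

variable [Fintype F]

theorem star_addChar (z : F) : star (ψ z) = ψ (-z) := (AddChar.map_neg_eq_conj ψ z).symm

/-- Since (v,z) ↦ (v,-z) is an isomorphism of the Heisenberg groups of the dual and of V, composing
with it and conjugating preserves the central character ψ. -/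
theorem exists_conj_dual {L : V.OrientedLag} (b : model ψ V L) :
    ∃ a : model ψ V.dual L.dual,
      ∀ x : V, a.1 (Heis.ofVec (V := V.dual) x) = star (b.1 (Heis.ofVec x)) := by
  refine ⟨⟨fun h => star (b.1 ⟨h.vec, -h.ctr⟩), fun z h => ?_, fun l hl h => ?_⟩, fun x => ?_⟩
  · have e : (⟨(Heis.ofCtr z * h).vec, -(Heis.ofCtr z * h).ctr⟩ : Heis V)
        = Heis.ofCtr (-z) * ⟨h.vec, -h.ctr⟩ := by
      ext
      · rfl
      · change -(z + h.ctr + 2⁻¹ * -(V.form 0 h.vec)) = -z + -h.ctr + 2⁻¹ * V.form 0 h.vec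
        simp [add_comm]
    beta_reduce
    rw [e, b.2.1, star_mul', star_addChar, neg_neg]
  · have e : (⟨(Heis.ofVec l * h).vec, -(Heis.ofVec l * h).ctr⟩ : Heis V)
        = Heis.ofVec (V := V) l * ⟨h.vec, -h.ctr⟩ := by
      ext
      · rfl
      · change -(0 + h.ctr + 2⁻¹ * -(V.form l h.vec)) = 0 + -h.ctr + 2⁻¹ * V.form l h.vec
        ring
    beta_reduce
    rw [e, b.2.2 l hl]
  · change star (b.1 ⟨x, -0⟩) = _
    rw [neg_zero]
    rfl

theorem exists_conj {L : V.OrientedLag} (a : model ψ V.dual L.dual) :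
    ∃ b : model ψ V L, ∀ x : V, b.1 (Heis.ofVec x) = star (a.1 (Heis.ofVec (V := V.dual) x)) := by
  refine ⟨⟨fun h => star (a.1 ⟨h.vec, -h.ctr⟩), fun z h => ?_, fun l hl h => ?_⟩, fun x => ?_⟩
  · have e : (⟨(Heis.ofCtr z * h).vec, -(Heis.ofCtr z * h).ctr⟩ : Heis V.dual)
        = Heis.ofCtr (-z) * ⟨h.vec, -h.ctr⟩ := by
      ext
      · rfl
      · change -(z + h.ctr + 2⁻¹ * V.form 0 h.vec) = -z + -h.ctr + 2⁻¹ * -(V.form 0 h.vec)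
        simp [add_comm]
    beta_reduce
    rw [e, a.2.1, star_mul', star_addChar, neg_neg]
  · have e : (⟨(Heis.ofVec l * h).vec, -(Heis.ofVec l * h).ctr⟩ : Heis V.dual)
        = Heis.ofVec (V := V.dual) l * ⟨h.vec, -h.ctr⟩ := by
      ext
      · rfl
      · change -(0 + h.ctr + 2⁻¹ * V.form l h.vec) = 0 + -h.ctr + 2⁻¹ * -(V.form l h.vec)
        ring
    beta_reduce
    rw [e, a.2.2 l hl]
  · change star (a.1 ⟨x, -0⟩) = _
    rw [neg_zero]
    rfl

/-- The pairing of functions on the Heisenberg groups of the dual and of `V`. -/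
def heisPairing (a : Heis V.dual → ℂ) (b : Heis V → ℂ) : ℂ :=
  ∑ x : V, a (Heis.ofVec (V := V.dual) x) * b (Heis.ofVec x)

/-- The phases ψ(∓ω(p,x)/2) from the two opposite forms cancel. -/
theorem heisPairing_translate {a : Heis V.dual → ℂ} {b : Heis V → ℂ}
    (ha : ∀ z h, a (Heis.ofCtr z * h) = ψ z * a h) (hb : ∀ z h, b (Heis.ofCtr z * h) = ψ z * b h)
    (p : V) :
    heisPairing (fun h => a (Heis.ofVec (V := V.dual) p * h)) (fun h => b (Heis.ofVec p * h))
      = heisPairing a b := by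
  refine Fintype.sum_equiv (Equiv.addLeft p) _ _ fun x => ?_
  have ea := (congrArg a (Heis.ofVec_mul_ofVec (V := V.dual) p x)).trans (ha _ _)
  have eb := (congrArg b (Heis.ofVec_mul_ofVec p x)).trans (hb _ _)
  refine (congrArg₂ (· * ·) ea eb).trans ?_
  rw [mul_mul_mul_comm, ← AddChar.map_add_eq_mul]
  have e : 2⁻¹ * V.dual.form p x + 2⁻¹ * V.form p x = 0 := by
    change 2⁻¹ * -(V.form p x) + 2⁻¹ * V.form p x = 0
    ring
  rw [e, AddChar.map_zero_eq_one, one_mul]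
  rfl

variable [DecidableEq F]

theorem normConst_dual (M L : V.OrientedLag) :
    normConst ψ V.dual M.dual L.dual = normConst ψ V L M := by
  rw [normConst_eq, normConst_eq, OrientedLag.dual_pairing_dual]
  rfl

/-- The averaging maps of the dual are adjoint to those of `V`. -/
theorem heisPairing_averaging {L M : V.OrientedLag} (a : model ψ V.dual L.dual)
    (b : model ψ V M) :
    heisPairing (averaging ψ M.dual L.dual a).1 b.1 = heisPairing a.1 (averaging ψ L M b).1 := by
  -- Both sides equal the constant times q^n times the pairing of `a` and `b`: the function not
  -- being averaged is invariant under the subgroup, so each term of the average is a simultaneous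
  -- translate.
  have h1 : heisPairing (averaging ψ M.dual L.dual a).1 b.1
      = normConst ψ V L M * ((Fintype.card F : ℂ) ^ V.halfDim * heisPairing a.1 b.1) := by
    have e : heisPairing (averaging ψ M.dual L.dual a).1 b.1 = normConst ψ V L M *
        ∑ m : M.space, heisPairing (fun h => a.1 (Heis.ofVec (V := V.dual) (m : V) * h)) b.1 := by
      simp only [heisPairing]
      rw [Finset.sum_comm, Finset.mul_sum]
      refine Finset.sum_congr rfl fun x _ => ?_
      rw [averaging_apply, normConst_dual, ← Finset.sum_mul, mul_assoc]
      rfl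
    rw [e, Finset.sum_congr rfl (g := fun _ => heisPairing a.1 b.1)]
    · rw [Finset.sum_const, nsmul_eq_mul, Finset.card_univ, card_lagrangian, Nat.cast_pow]
    · intro m _
      rw [← heisPairing_translate a.2.1 b.2.1 m]
      congr 1
      ext h
      rw [b.2.2 m m.2]
  have h2 : heisPairing a.1 (averaging ψ L M b).1
      = normConst ψ V L M * ((Fintype.card F : ℂ) ^ V.halfDim * heisPairing a.1 b.1) := by
    have e : heisPairing a.1 (averaging ψ L M b).1 = normConst ψ V L M *
        ∑ l : L.space, heisPairing a.1 (fun h => b.1 (Heis.ofVec (l : V) * h)) := by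
      simp only [heisPairing]
      rw [Finset.sum_comm, Finset.mul_sum]
      refine Finset.sum_congr rfl fun x _ => ?_
      rw [averaging_apply, ← Finset.mul_sum, mul_left_comm]
    rw [e, Finset.sum_congr rfl (g := fun _ => heisPairing a.1 b.1)]
    · rw [Finset.sum_const, nsmul_eq_mul, Finset.card_univ, card_lagrangian, Nat.cast_pow]
    · intro l _
      rw [← heisPairing_translate a.2.1 b.2.1 l]
      congr 1
      ext h
      exact (a.2.2 (l : V) l.2 h).symm
  rw [h1, h2]

theorem IsCanonical.unique (hF : ringChar F ≠ 2) {K K' : IntertwiningSystem ψ V}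
    (hK : IsCanonical K) (hK' : IsCanonical K') : K = K' := by
  funext M L
  obtain ⟨P, hL, hM⟩ := exists_orientedLag_disjoint (Ring.two_ne_zero hF) L M
  rw [hK.eq_averaging_comp hL hM, hK'.eq_averaging_comp hL hM]

theorem canonicalSpace_averaging (hF : ringChar F ≠ 2) (hψ : ψ ≠ 1) (v : canonicalSpace ψ V)
    {M L : V.OrientedLag} (h : Disjoint M.space L.space) : averaging ψ M L (v.1 L) = v.1 M := by
  obtain ⟨K, hK⟩ := exists_isCanonical hF hψ V
  rw [← hK.eq_averaging h]
  exact v.2 K hK M L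

theorem canonicalSpace_eq_zero (hF : ringChar F ≠ 2) (hψ : ψ ≠ 1) {v : canonicalSpace ψ V}
    {L : V.OrientedLag} (h : v.1 L = 0) : v = 0 := by
  obtain ⟨K, hK⟩ := exists_isCanonical hF hψ V
  apply Subtype.ext
  funext M
  rw [← v.2 K hK M L, h, map_zero]
  rfl

/-- Together with `canonicalSpace_eq_zero`, this makes evaluation at any one L an isomorphism onto
H_L. -/
theorem exists_canonicalSpace_eq (hF : ringChar F ≠ 2) (hψ : ψ ≠ 1) {L : V.OrientedLag}
    (w : model ψ V L) : ∃ v : canonicalSpace ψ V, v.1 L = w := by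
  obtain ⟨K, hK⟩ := exists_isCanonical hF hψ V
  refine ⟨⟨fun M => K M L w, fun K' hK' M N => ?_⟩, ?_⟩
  · change K' M N (K N L w) = K M L w
    -- `canonicalSpace` quantifies over all canonical systems; uniqueness leaves only `K`.
    rw [hK'.unique hF hK, hK.multiplicative M N L]
    rfl
  · obtain ⟨P, hL, -⟩ := exists_orientedLag_disjoint (Ring.two_ne_zero hF) L L
    change K L L w = w
    rw [hK.eq_averaging_comp hL hL, averaging_comp_self hF hψ hL]
    rfl

/-- For transverse L and M this is adjointness; in general, pass through a common complement. The
Lagrangian chosen in `canonicalPairing` is therefore immaterial. -/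
theorem heisPairing_eq (hF : ringChar F ≠ 2) (hψ : ψ ≠ 1) (a : canonicalSpace ψ V.dual)
    (b : canonicalSpace ψ V) (L M : V.OrientedLag) :
    heisPairing (a.1 L.dual).1 (b.1 L).1 = heisPairing (a.1 M.dual).1 (b.1 M).1 := by
  have key : ∀ L M : V.OrientedLag, Disjoint M.space L.space →
      heisPairing (a.1 L.dual).1 (b.1 L).1 = heisPairing (a.1 M.dual).1 (b.1 M).1 := by
    intro L M h
    rw [← canonicalSpace_averaging hF hψ a (M := M.dual) (L := L.dual) h, heisPairing_averaging,
      canonicalSpace_averaging hF hψ b h.symm]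
  obtain ⟨P, hL, hM⟩ := exists_orientedLag_disjoint (Ring.two_ne_zero hF) L M
  rw [key L P hL, key M P hM]

/-- The pairing of the canonical vector spaces of the dual and of `V`. -/
def canonicalPairing (ψ : AddChar F ℂ) (V : Symp.{u} F) :
    canonicalSpace ψ V.dual →ₗ[ℂ] canonicalSpace ψ V →ₗ[ℂ] ℂ :=
  LinearMap.mk₂ ℂ (fun a b => heisPairing (a.1 (nonempty_orientedLag V).some.dual).1
      (b.1 (nonempty_orientedLag V).some).1)
    (fun a a' b => by
      simp only [heisPairing, ← Finset.sum_add_distrib, ← add_mul]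
      rfl)
    (fun c a b => by
      simp only [heisPairing, smul_eq_mul, Finset.mul_sum, ← mul_assoc]
      rfl)
    (fun a b b' => by
      simp only [heisPairing, ← Finset.sum_add_distrib, ← mul_add]
      rfl)
    (fun c a b => by
      simp only [heisPairing, smul_eq_mul, Finset.mul_sum, mul_left_comm c]
      rfl)

theorem canonicalPairing_apply (hF : ringChar F ≠ 2) (hψ : ψ ≠ 1) (a : canonicalSpace ψ V.dual)
    (b : canonicalSpace ψ V) (L : V.OrientedLag) :
    canonicalPairing ψ V a b = heisPairing (a.1 L.dual).1 (b.1 L).1 :=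
  heisPairing_eq hF hψ a b _ L

/-- Pairing a family with one whose component at L is the complex conjugate gives the sum of squared
absolute values over V × {0}, and these values determine the component. -/
theorem canonicalPairing_nondegenerate (hF : ringChar F ≠ 2) (hψ : ψ ≠ 1) (V : Symp.{u} F) :
    (canonicalPairing ψ V).Nondegenerate := by
  obtain ⟨L⟩ := nonempty_orientedLag V
  refine ⟨fun a ha => ?_, fun b hb => ?_⟩
  · obtain ⟨b₀, hb₀⟩ := exists_conj (a.1 L.dual)
    obtain ⟨b, rfl⟩ := exists_canonicalSpace_eq hF hψ b₀
    have h := ha b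
    rw [canonicalPairing_apply hF hψ a b L, heisPairing] at h
    simp only [hb₀, mul_comm _ (star _)] at h
    exact canonicalSpace_eq_zero hF hψ (L := L.dual) (model_eq_zero (eq_zero_of_sum_star_mul h))
  · obtain ⟨a₀, ha₀⟩ := exists_conj_dual (b.1 L)
    obtain ⟨a, rfl⟩ := exists_canonicalSpace_eq hF hψ a₀
    have h := hb a
    rw [canonicalPairing_apply hF hψ a b L, heisPairing] at h
    simp only [ha₀] at h
    exact canonicalSpace_eq_zero hF hψ (model_eq_zero (eq_zero_of_sum_star_mul h))

/-- Computing the pairing of V at L and that of U at f(L) turns the identity into the substitution x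
↦ f(x). -/
theorem canonicalPairing_canonicalMap (hF : ringChar F ≠ 2) (hψ : ψ ≠ 1) {V U : Symp.{u} F}
    (f : Iso V U) (a : canonicalSpace ψ U.dual) (b : canonicalSpace ψ U) :
    canonicalPairing ψ V (f.dual.canonicalMap ψ a) (f.canonicalMap ψ b)
      = canonicalPairing ψ U a b := by
  obtain ⟨L⟩ := nonempty_orientedLag V
  rw [canonicalPairing_apply hF hψ _ _ L, canonicalPairing_apply hF hψ a b (f.lag L)]
  exact Fintype.sum_equiv f.toLinearEquiv.toEquiv _ _ fun x => rfl

end Dual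

end Symp

end

theorem proposition4 {F : Type v} [Field F] [Fintype F] [DecidableEq F]
    (hF : ringChar F ≠ 2) (ψ : AddChar F ℂ) (hψ : ψ ≠ 1) :
    -- the canonical system of intertwining morphisms, on which `H(V, ψ)` rests, exists uniquely
    (∀ V : Symp.{u} F, ∃! K : Symp.IntertwiningSystem ψ V, Symp.IsCanonical K) ∧
    -- the natural non-degenerate pairing
    ∃ B : ∀ V : Symp.{u} F,
        Symp.canonicalSpace ψ V.dual →ₗ[ℂ] Symp.canonicalSpace ψ V →ₗ[ℂ] ℂ,
      (∀ V : Symp.{u} F, (B V).Nondegenerate) ∧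
      ∀ (V U : Symp.{u} F) (f : Symp.Iso V U)
        (a : Symp.canonicalSpace ψ U.dual) (b : Symp.canonicalSpace ψ U),
        B V (f.dual.canonicalMap ψ a) (f.canonicalMap ψ b) = B U a b := by
  refine ⟨fun V => ?_, Symp.canonicalPairing ψ, Symp.canonicalPairing_nondegenerate hF hψ,
    fun V U f => Symp.canonicalPairing_canonicalMap hF hψ f⟩
  obtain ⟨K, hK⟩ := Symp.exists_isCanonical hF hψ V
  exact ⟨K, hK, fun K' hK' => hK'.unique hF hK⟩
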